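/- Let $P\subseteq\mathbb R^2$ be a half-integral polygon, that is, the convex hull of finitely many rational points, with affine hull $\mathbb R^2$, such that the smallest integer $d\ge 1$ for which $dP$ is a lattice polygon (a convex hull of finitely many points of $\mathbb Z^2$) is $d=2$. For such a polygon, or an integer dilate $Q$ of it, let $l(Q)$, $i(Q)$, $b(Q)$ be the numbers of points of $\mathbb Z^2$ in $Q$, in the interior of $Q$ and on the boundary of $Q$, and let $\operatorname{area}(Q)$ be its area. There is a unique quasi-polynomial $\operatorname{ehr}_P(t)=e_2(t)t^2+e_1(t)t+e_0(t)$ of degree $2$ (the $e_j:\mathbb Z\to\mathbb Q$ are periodic with positive integral periods, $e_2\not\equiv 0$) such that $\operatorname{ehr}_P(k)=l(kP)$ for all positive integers $k$. There are unique polynomials $\operatorname{ehr}_{P,\mathrm{odd}}$ and $\operatorname{ehr}_{P,\mathrm{even}}$ whose values agree with $\operatorname{ehr}_P$ at all odd, respectively all even, integers, and they are \begin{align*} \operatorname{ehr}_{P,\mathrm{odd}}(t)&=\operatorname{area}(P)\,t^2+\tfrac{b(P)}{2}\,t+l(P)-\operatorname{area}(P)-\tfrac{b(P)}{2},\\ \operatorname{ehr}_{P,\mathrm{even}}(t)&=\operatorname{area}(P)\,t^2+\tfrac{b(2P)}{4}\,t+1.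 \end{align*} Moreover, writing the period sequence of $P$ as the vector of the smallest positive periods of $e_0,e_1,e_2$ (with $\ast$ for an arbitrary entry): \begin{itemize} \item the period sequence is $(1,\ast,1)$ if and only if $l(P)-\operatorname{area}(P)-\frac{b(P)}{2}=1$, and this equation is equivalent to Pick's formula $\operatorname{area}(P)=i(P)+\frac{b(P)}{2}-1$; \item the period sequence is $(\ast,1,1)$ if and only if $e\cap\mathbb Z^2\neq\emptyset$ for every edge $e$ of $P$. \end{itemize} In particular, $P$ is pseudo-integral (the least common multiple of the periods of $e_0,e_1,e_2$ is $1$, i.e. $\operatorname{ehr}_P$ is a polynomial) if and only if $P$ obeys Pick's formula and every edge of $P$ contains a lattice point. -/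

import Mathlib

open MeasureTheory Polynomial
open scoped Pointwise

namespace Ehrhart

/-- The lattice `ℤⁿ` inside `ℝⁿ`. -/
def intLattice (n : ℕ) : Set (Fin n → ℝ) := {x | ∀ i, ∃ z : ℤ, x i = (z : ℝ)}

/-- The rational points `ℚⁿ` inside `ℝⁿ`. -/
def ratPoints (n : ℕ) : Set (Fin n → ℝ) := {x | ∀ i, ∃ r : ℚ, x i = (r : ℝ)}

/-- A full-dimensional rational polytope: the convex hull of finitely many rational points,
with affine hull all of `ℝⁿ`. -/
def IsRationalPolytope {n : ℕ} (P : Set (Fin n → ℝ)) : Prop :=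
  (∃ S : Set (Fin n → ℝ), S.Finite ∧ S ⊆ ratPoints n ∧ P = convexHull ℝ S) ∧
    affineSpan ℝ P = ⊤

/-- A (full-dimensional) lattice polytope. -/
def IsLatticePolytope {n : ℕ} (P : Set (Fin n → ℝ)) : Prop :=
  (∃ S : Set (Fin n → ℝ), S.Finite ∧ S ⊆ intLattice n ∧ P = convexHull ℝ S) ∧
    affineSpan ℝ P = ⊤

/-- The denominator of `P`: the smallest positive integer `d` such that `d P` is a lattice
polytope (and `0` if there is no such integer, which does not happen for a rational polytope). -/
noncomputable def denom {n : ℕ} (P : Set (Fin n → ℝ)) : ℕ :=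
  sInf {d : ℕ | 1 ≤ d ∧ IsLatticePolytope ((d : ℝ) • P)}

/-- A half-integral polygon: a rational polygon in the plane with denominator `2`. -/
def IsHalfIntegralPolygon (P : Set (Fin 2 → ℝ)) : Prop :=
  IsRationalPolytope P ∧ denom P = 2

/-- The number `l(P)` of lattice points of `P`. -/
noncomputable def latticeCount {n : ℕ} (P : Set (Fin n → ℝ)) : ℕ :=
  (P ∩ intLattice n).ncard

/-- The number `i(P)` of interior lattice points of `P`. -/
noncomputable def interiorCount {n : ℕ} (P : Set (Fin n → ℝ)) : ℕ :=
  (interior P ∩ intLattice n).ncard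

/-- The number `b(P)` of boundary lattice points of `P`. -/
noncomputable def boundaryCount {n : ℕ} (P : Set (Fin n → ℝ)) : ℕ :=
  (frontier P ∩ intLattice n).ncard

/-- The area of a plane set, i.e. its Lebesgue measure. -/
noncomputable def area (P : Set (Fin 2 → ℝ)) : ℝ := (volume : Measure (Fin 2 → ℝ)).real P

/-- `P` obeys Pick's formula. -/
def ObeysPick (P : Set (Fin 2 → ℝ)) : Prop :=
  area P = (interiorCount P : ℝ) + (boundaryCount P : ℝ) / 2 - 1

/-- `e` is an edge of `P`: a one-dimensional (exposed) face. -/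
def IsEdge {n : ℕ} (P e : Set (Fin n → ℝ)) : Prop :=
  IsExposed ℝ P e ∧ Module.finrank ℝ (vectorSpan ℝ e) = 1

/-- A quasi-polynomial of degree `n`: coefficient functions on the integers with rational values,
each periodic with some positive integral period, the top one not identically zero. -/
@[ext]
structure QuasiPolynomial (n : ℕ) where
  coeff : Fin (n + 1) → ℤ → ℚ
  periodic : ∀ k, ∃ p : ℕ, 0 < p ∧ Function.Periodic (coeff k) (p : ℤ)
  coeff_last_ne_zero : coeff (Fin.last n) ≠ 0

namespace QuasiPolynomial

/-- The value `q(t) = ∑ₖ qₖ(t) tᵏ` at an integer `t`. -/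
def eval {n : ℕ} (q : QuasiPolynomial n) (t : ℤ) : ℚ :=
  ∑ k : Fin (n + 1), q.coeff k t * (t : ℚ) ^ (k : ℕ)

/-- The period sequence: entry `k` is the smallest positive period of the coefficient
function `qₖ`. -/
noncomputable def periodSequence {n : ℕ} (q : QuasiPolynomial n) (k : Fin (n + 1)) : ℕ :=
  sInf {p : ℕ | 0 < p ∧ Function.Periodic (q.coeff k) (p : ℤ)}

/-- The quasi-period: the least common multiple of the periods of the coefficient functions. -/
noncomputable def quasiPeriod {n : ℕ} (q : QuasiPolynomial n) : ℕ :=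
  Finset.univ.lcm q.periodSequence

/-- The polynomial `p` gives the values of `q` at all odd integers. -/
def IsOddPart {n : ℕ} (q : QuasiPolynomial n) (p : ℝ[X]) : Prop :=
  ∀ k : ℤ, Odd k → ((q.eval k : ℚ) : ℝ) = p.eval (k : ℝ)

/-- The polynomial `p` gives the values of `q` at all even integers. -/
def IsEvenPart {n : ℕ} (q : QuasiPolynomial n) (p : ℝ[X]) : Prop :=
  ∀ k : ℤ, Even k → ((q.eval k : ℚ) : ℝ) = p.eval (k : ℝ)

end QuasiPolynomial

/-- `q` is an Ehrhart quasi-polynomial of `P`: it has degree `n` and `q(k) = l(kP)` for all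
positive integers `k`. -/
def IsEhrhart {n : ℕ} (P : Set (Fin n → ℝ)) (q : QuasiPolynomial n) : Prop :=
  ∀ k : ℕ, 0 < k → q.eval (k : ℤ) = (latticeCount ((k : ℝ) • P) : ℚ)

/-- `P` is pseudo-integral: its Ehrhart quasi-polynomial has quasi-period `1`. -/
def IsPseudoIntegral {n : ℕ} (P : Set (Fin n → ℝ)) : Prop :=
  ∃ q : QuasiPolynomial n, IsEhrhart P q ∧ q.quasiPeriod = 1

end Ehrhart

/-!
Write `scaledCount k A` for the number of points of `A` in `k⁻¹ ℤ²`, which is also the number of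
lattice points of `k A`. All counts below are studied for `k > 0` in a fixed residue class mod `2`.

**Simplices.** Let `v` be the vertices of a half-integral segment or triangle. The lattice points
of the cone over `v` form a group `coneGroup v` of vectors of barycentric coordinates containing
twice each unit vector. Reducing coordinates mod `2` writes a point of a closed slice uniquely as
`π + 2 a` with `π` in the half-open box `[0, 2)` and `a` a vector of natural numbers, and a point
with positive coordinates uniquely as `2 (a + 1) - π`. Summing binomial coefficients over the
finitely many `π` gives polynomials in `k` for the count of the closed simplex and for that of its
relative interior, related by `k ↦ -k` up to sign (`exists_segment_counts`,
`exists_triangle_counts`). For even `k` only `π = 0` contributes to the constant term, which is `1`.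

**Polygons.** A polygon with more than three vertices has a diagonal with vertices on both sides
(`exists_diagonal`). Cutting along it gives two polygons with fewer vertices. The closed polygon is
their union, with the diagonal as intersection; the interior is the disjoint union of the two
interiors and the open diagonal. So reciprocity passes to all polygons by induction
(`exists_polygon_counts`): the polygon has `α k² + β k + γ` points and its interior has
`α k² - β k + γ`. Subtracting, the boundary has `2 β k` points, which determines `β`; the
coefficient `α` is the area because the counts divided by `k²` converge to it (`polygon_counts`).

**Edges.** Up to a bounded error the boundary count is the sum of the counts of the edges, as
finitely many edges cover the boundary up to finitely many points and overlap in finitely many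
points. For one edge, the slope of the count for odd `k` is at most the slope for even `k`. If the
edge has a lattice point `z`, then `x ↦ (k x + z) / (k + 1)` shows that the count is monotone in
`k` and the slopes agree; if not, the counts for `k = 1` vanish, so by reciprocity the
odd slope is `0`, while the even slope is positive. Summing over the edges, `b(2P) = 2 b(P)` holds exactly when every edge
has a lattice point (`frontier_count_two_eq_iff`).
-/

namespace Ehrhart

/-! ### Lattice points in slices of simplicial cones -/

section Combinatorics

variable {ι : Type*} [Fintype ι] {M : AddSubgroup (ι → ℝ)}

theorem add_two_smul_nat_mem [DecidableEq ι] (hM : ∀ i, Pi.single i (2 : ℝ) ∈ M) (a : ι → ℤ) :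
    (fun i => 2 * (a i : ℝ)) ∈ M := by
  have h : (fun i => 2 * (a i : ℝ)) = ∑ i, a i • Pi.single i (2 : ℝ) := by
    ext j
    simp [Finset.sum_apply, Pi.single_apply, mul_comm]
  rw [h]
  exact sum_mem fun i _ => M.zsmul_mem (hM i) _

theorem finite_nat_sum_eq (x y : ℝ) :
    {a : ι → ℕ | x + 2 * ∑ i, (a i : ℝ) = y}.Finite := by
  refine (Set.Finite.pi (t := fun _ : ι => Set.Iic ⌈(y - x) / 2⌉₊)
    fun _ => Set.finite_Iic _).subset ?_
  intro a ha i _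
  have h1 : (a i : ℝ) ≤ ∑ i, (a i : ℝ) :=
    Finset.single_le_sum (f := fun i => (a i : ℝ)) (fun j _ => by positivity) (Finset.mem_univ i)
  have h2 : x + 2 * ∑ i, (a i : ℝ) = y := ha
  have h3 : (a i : ℝ) ≤ (⌈(y - x) / 2⌉₊ : ℝ) := le_trans (by linarith) (Nat.le_ceil _)
  exact_mod_cast h3

/-- Reduction of the coordinates mod `2` into `[0, 2)`: `c = π + 2 a`. -/
theorem ncard_closed_cone_slice [DecidableEq ι] (hM : ∀ i, Pi.single i (2 : ℝ) ∈ M)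
    (hB : {c | c ∈ M ∧ ∀ i, 0 ≤ c i ∧ c i < 2}.Finite) (k : ℝ) :
    {c | c ∈ M ∧ (∀ i, 0 ≤ c i) ∧ ∑ i, c i = k}.ncard =
      ∑ π ∈ hB.toFinset, {a : ι → ℕ | ∑ i, π i + 2 * ∑ i, (a i : ℝ) = k}.ncard := by
  classical
  have hfin : ∀ π : ι → ℝ, Finite {a : ι → ℕ | ∑ i, π i + 2 * ∑ i, (a i : ℝ) = k} :=
    fun π => finite_nat_sum_eq _ _
  rw [← Finset.sum_coe_sort]
  simp only [← Nat.card_coe_set_eq]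
  rw [← Nat.card_sigma]
  symm
  refine Nat.card_congr (Equiv.ofBijective (fun p => ⟨fun i => p.1.1 i + 2 * (p.2.1 i : ℝ), ?_⟩) ?_)
  · obtain ⟨⟨π, hπ⟩, a, ha⟩ := p
    rw [Set.Finite.mem_toFinset] at hπ
    refine ⟨?_, fun i => ?_, ?_⟩
    · have := M.add_mem hπ.1 (add_two_smul_nat_mem hM (fun i => (a i : ℤ)))
      convert this using 1
      ext i; simp
    · have := (hπ.2 i).1
      dsimp only
      positivity
    · rw [Finset.sum_add_distrib, ← Finset.mul_sum]; exact ha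
  · constructor
    · rintro ⟨⟨π, hπ⟩, a, ha⟩ ⟨⟨π', hπ'⟩, a', ha'⟩ h
      rw [Set.Finite.mem_toFinset] at hπ hπ'
      have h1 : ∀ i, π i + 2 * (a i : ℝ) = π' i + 2 * (a' i : ℝ) := fun i =>
        congrFun (congrArg Subtype.val h) i
      have h2 : a = a' := by
        ext i
        have e := h1 i
        have b1 := hπ.2 i
        have b2 := hπ'.2 i
        have u1 : (a i : ℝ) < a' i + 1 := by linarith
        have u2 : (a' i : ℝ) < a i + 1 := by linarith
        have u1' : a i < a' i + 1 := by exact_mod_cast u1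
        have u2' : a' i < a i + 1 := by exact_mod_cast u2
        omega
      subst h2
      have h3 : π = π' := by
        ext i; have := h1 i; linarith
      subst h3
      rfl
    · rintro ⟨c, hc, hc0, hck⟩
      have hfl : ∀ i, 0 ≤ c i / 2 := fun i => by have := hc0 i; positivity
      refine ⟨⟨⟨fun i => c i - 2 * (⌊c i / 2⌋₊ : ℝ), ?_⟩, fun i => ⌊c i / 2⌋₊, ?_⟩, ?_⟩
      · rw [Set.Finite.mem_toFinset]
        refine ⟨?_, fun i => ⟨?_, ?_⟩⟩
        · have := M.sub_mem hc (add_two_smul_nat_mem hM (fun i => (⌊c i / 2⌋₊ : ℤ)))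
          convert this using 1
          ext i; simp
        · have := Nat.floor_le (hfl i); linarith
        · have := Nat.lt_floor_add_one (c i / 2); linarith
      · show ∑ i, (c i - 2 * (⌊c i / 2⌋₊ : ℝ)) + 2 * ∑ i, (⌊c i / 2⌋₊ : ℝ) = k
        rw [Finset.sum_sub_distrib, ← Finset.mul_sum]; linarith
      · apply Subtype.ext; ext i; simp

/-- Reduction of positive coordinates mod `2` into `(0, 2]`, where the remainder is written `2 - π`
with `π` in the same box `[0, 2)` as for the closed slice: `c = 2 (a + 1) - π`. The common index set
is the source of reciprocity. -/
theorem ncard_open_cone_slice [DecidableEq ι] (hM : ∀ i, Pi.single i (2 : ℝ) ∈ M)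
    (hB : {c | c ∈ M ∧ ∀ i, 0 ≤ c i ∧ c i < 2}.Finite) (k : ℝ) :
    {c | c ∈ M ∧ (∀ i, 0 < c i) ∧ ∑ i, c i = k}.ncard =
      ∑ π ∈ hB.toFinset,
        {a : ι → ℕ | (2 * Fintype.card ι - ∑ i, π i) + 2 * ∑ i, (a i : ℝ) = k}.ncard := by
  classical
  have hfin : ∀ π : ι → ℝ,
      Finite {a : ι → ℕ | (2 * Fintype.card ι - ∑ i, π i) + 2 * ∑ i, (a i : ℝ) = k} :=
    fun π => finite_nat_sum_eq _ _
  rw [← Finset.sum_coe_sort]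
  simp only [← Nat.card_coe_set_eq]
  rw [← Nat.card_sigma]
  symm
  refine Nat.card_congr
    (Equiv.ofBijective (fun p => ⟨fun i => 2 * ((p.2.1 i : ℝ) + 1) - p.1.1 i, ?_⟩) ?_)
  · obtain ⟨⟨π, hπ⟩, a, ha⟩ := p
    rw [Set.Finite.mem_toFinset] at hπ
    refine ⟨?_, fun i => ?_, ?_⟩
    · have := M.sub_mem (add_two_smul_nat_mem hM (fun i => (a i : ℤ) + 1)) hπ.1
      convert this using 1
      ext i; simp
    · have := (hπ.2 i).2
      have : (0 : ℝ) ≤ a i := by positivity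
      dsimp only
      linarith
    · rw [Finset.sum_sub_distrib, ← Finset.mul_sum, Finset.sum_add_distrib]
      have ha' : (2 * Fintype.card ι - ∑ i, π i) + 2 * ∑ i, (a i : ℝ) = k := ha
      simp only [Finset.sum_const, Finset.card_univ, nsmul_eq_mul, mul_one]
      linarith
  · constructor
    · rintro ⟨⟨π, hπ⟩, a, ha⟩ ⟨⟨π', hπ'⟩, a', ha'⟩ h
      rw [Set.Finite.mem_toFinset] at hπ hπ'
      have h1 : ∀ i, 2 * ((a i : ℝ) + 1) - π i = 2 * ((a' i : ℝ) + 1) - π' i := fun i =>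
        congrFun (congrArg Subtype.val h) i
      have h2 : a = a' := by
        ext i
        have e := h1 i
        have b1 := hπ.2 i
        have b2 := hπ'.2 i
        have u1 : (a i : ℝ) < a' i + 1 := by linarith
        have u2 : (a' i : ℝ) < a i + 1 := by linarith
        have u1' : a i < a' i + 1 := by exact_mod_cast u1
        have u2' : a' i < a i + 1 := by exact_mod_cast u2
        omega
      subst h2
      have h3 : π = π' := by
        ext i; have := h1 i; linarith
      subst h3
      rfl
    · rintro ⟨c, hc, hc0, hck⟩
      have hpos : ∀ i, 0 < ⌈c i / 2⌉₊ := fun i => Nat.ceil_pos.2 (by have := hc0 i; positivity)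
      have hcast : ∀ i, ((⌈c i / 2⌉₊ - 1 : ℕ) : ℝ) = (⌈c i / 2⌉₊ : ℝ) - 1 := fun i => by
        rw [Nat.cast_sub (hpos i)]; simp
      refine ⟨⟨⟨fun i => 2 * (⌈c i / 2⌉₊ : ℝ) - c i, ?_⟩, fun i => ⌈c i / 2⌉₊ - 1, ?_⟩, ?_⟩
      · rw [Set.Finite.mem_toFinset]
        refine ⟨?_, fun i => ⟨?_, ?_⟩⟩
        · have := M.sub_mem (add_two_smul_nat_mem hM (fun i => (⌈c i / 2⌉₊ : ℤ))) hc
          convert this using 1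
          ext i; simp
        · have := Nat.le_ceil (c i / 2); linarith
        · have := Nat.ceil_lt_add_one (a := c i / 2) (by have := hc0 i; positivity); linarith
      · show (2 * Fintype.card ι - ∑ i, (2 * (⌈c i / 2⌉₊ : ℝ) - c i)) +
          2 * ∑ i, ((⌈c i / 2⌉₊ - 1 : ℕ) : ℝ) = k
        simp only [hcast]
        rw [Finset.sum_sub_distrib, ← Finset.mul_sum, Finset.sum_sub_distrib]
        simp only [Finset.sum_const, Finset.card_univ, nsmul_eq_mul, mul_one]
        linarith
      · apply Subtype.ext; ext i; simp [hcast]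

end Combinatorics

theorem ncard_sum_eq {ι : Type*} [Fintype ι] (m : ℕ) :
    {a : ι → ℕ | ∑ i, a i = m}.ncard = (Fintype.card ι).multichoose m := by
  classical
  have : {a : ι → ℕ | ∑ i, a i = m} =
      (fun f : ι →₀ ℕ => (f : ι → ℕ)) ''
        ((Finset.finsuppAntidiag Finset.univ m : Finset (ι →₀ ℕ)) : Set (ι →₀ ℕ)) := by
    ext a
    simp only [Set.mem_ofPred_eq, Set.mem_image, Finset.mem_coe, Finset.mem_finsuppAntidiag]
    exact ⟨fun h => ⟨Finsupp.equivFunOnFinite.symm a, ⟨by simpa using h, by simp⟩, by simp⟩,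
      by rintro ⟨f, ⟨h, -⟩, rfl⟩; exact h⟩
  rw [this, Set.ncard_image_of_injective _ DFunLike.coe_injective, Set.ncard_coe_finset,
    Finset.card_finsuppAntidiag_nat_eq_multichoose, Finset.card_univ]

/-- The closed formula remains valid for the small negative values of `(k - h) / 2` that occur for
`h ≤ 4`: there are no solutions then, and the binomial polynomial vanishes. -/
theorem ncard_fiber_fin_two {h k : ℕ} (hh : h ≤ 4) (hk : 0 < k) :
    ({a : Fin 2 → ℕ | (h : ℝ) + 2 * ∑ i, (a i : ℝ) = k}.ncard : ℝ) =
      if h % 2 = k % 2 then ((k : ℝ) - h) / 2 + 1 else 0 := by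
  have hset : {a : Fin 2 → ℕ | (h : ℝ) + 2 * ∑ i, (a i : ℝ) = k} =
      {a : Fin 2 → ℕ | h + 2 * ∑ i, a i = k} := by
    ext a
    simp only [Set.mem_ofPred_eq]
    exact_mod_cast Iff.rfl
  rw [hset]
  split_ifs with hp
  · rcases le_or_gt h k with hle | hlt
    · obtain ⟨m, rfl⟩ : ∃ m, k = h + 2 * m := ⟨(k - h) / 2, by omega⟩
      have : {a : Fin 2 → ℕ | h + 2 * ∑ i, a i = h + 2 * m} = {a : Fin 2 → ℕ | ∑ i, a i = m} := by
        ext a; simp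
      rw [this, ncard_sum_eq, Fintype.card_fin, Nat.multichoose_two]
      push_cast; ring
    · have : {a : Fin 2 → ℕ | h + 2 * ∑ i, a i = k} = ∅ := by
        ext a; simp only [Set.mem_ofPred_eq, Set.mem_empty_iff_false, iff_false]; omega
      have h2 : h = k + 2 := by omega
      rw [this, h2]; simp
  · have : {a : Fin 2 → ℕ | h + 2 * ∑ i, a i = k} = ∅ := by
      ext a; simp only [Set.mem_ofPred_eq, Set.mem_empty_iff_false, iff_false]; omega
    rw [this]; simp

/-- As for pairs, the binomial polynomial vanishes at the negative values `-1` and `-2` of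
`(k - h) / 2`, which are the only ones that occur for `h ≤ 6`. -/
theorem ncard_fiber_fin_three {h k : ℕ} (hh : h ≤ 6) (hk : 0 < k) :
    ({a : Fin 3 → ℕ | (h : ℝ) + 2 * ∑ i, (a i : ℝ) = k}.ncard : ℝ) =
      if h % 2 = k % 2 then (((k : ℝ) - h) / 2 + 1) * (((k : ℝ) - h) / 2 + 2) / 2 else 0 := by
  have hset : {a : Fin 3 → ℕ | (h : ℝ) + 2 * ∑ i, (a i : ℝ) = k} =
      {a : Fin 3 → ℕ | h + 2 * ∑ i, a i = k} := by
    ext a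
    simp only [Set.mem_ofPred_eq]
    exact_mod_cast Iff.rfl
  rw [hset]
  split_ifs with hp
  · rcases le_or_gt h k with hle | hlt
    · obtain ⟨m, rfl⟩ : ∃ m, k = h + 2 * m := ⟨(k - h) / 2, by omega⟩
      have : {a : Fin 3 → ℕ | h + 2 * ∑ i, a i = h + 2 * m} = {a : Fin 3 → ℕ | ∑ i, a i = m} := by
        ext a; simp
      rw [this, ncard_sum_eq, Fintype.card_fin, Nat.multichoose_eq,
        show 3 + m - 1 = m + 2 by omega, Nat.choose_symm_add, Nat.cast_choose_two]
      push_cast; ring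
    · have : {a : Fin 3 → ℕ | h + 2 * ∑ i, a i = k} = ∅ := by
        ext a; simp only [Set.mem_ofPred_eq, Set.mem_empty_iff_false, iff_false]; omega
      have h2 : h = k + 2 ∨ h = k + 4 := by omega
      rw [this]
      rcases h2 with h2 | h2 <;> (rw [h2]; push_cast; simp; try ring)
  · have : {a : Fin 3 → ℕ | h + 2 * ∑ i, a i = k} = ∅ := by
      ext a; simp only [Set.mem_ofPred_eq, Set.mem_empty_iff_false, iff_false]; omega
    rw [this]; simp

/-! ### Half-integral segments and triangles -/

theorem zero_mem_intLattice {n : ℕ} : (0 : Fin n → ℝ) ∈ intLattice n := fun _ => ⟨0, by simp⟩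

theorem add_mem_intLattice {n : ℕ} {x y : Fin n → ℝ} (hx : x ∈ intLattice n)
    (hy : y ∈ intLattice n) : x + y ∈ intLattice n := fun i => by
  obtain ⟨a, ha⟩ := hx i
  obtain ⟨b, hb⟩ := hy i
  exact ⟨a + b, by simp [ha, hb]⟩

theorem neg_mem_intLattice {n : ℕ} {x : Fin n → ℝ} (hx : x ∈ intLattice n) :
    -x ∈ intLattice n := fun i => by
  obtain ⟨a, ha⟩ := hx i
  exact ⟨-a, by simp [ha]⟩

theorem finite_inter_intLattice {n : ℕ} {A : Set (Fin n → ℝ)} (hA : Bornology.IsBounded A) :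
    (A ∩ intLattice n).Finite := by
  obtain ⟨R, hR⟩ := hA.subset_closedBall 0
  have hfin : (Set.univ.pi fun _ : Fin n => Set.Icc (-⌈R⌉) ⌈R⌉).Finite :=
    Set.Finite.pi fun _ => Set.finite_Icc _ _
  refine (hfin.image fun (z : Fin n → ℤ) i => (z i : ℝ)).subset ?_
  rintro x ⟨hxA, hx⟩
  choose z hz using hx
  refine ⟨z, fun i _ => ?_, funext fun i => (hz i).symm⟩
  have h1 : ‖x i‖ ≤ R := (norm_le_pi_norm x i).trans (by simpa using hR hxA)
  rw [hz i, Real.norm_eq_abs, abs_le] at h1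
  have h2 := Int.le_ceil R
  constructor
  · have : ((-⌈R⌉ : ℤ) : ℝ) ≤ z i := by push_cast; linarith
    exact_mod_cast this
  · have : (z i : ℝ) ≤ (⌈R⌉ : ℤ) := by linarith
    exact_mod_cast this

/-- The number of points of `A` in the refined lattice `k⁻¹ ℤⁿ`. -/
noncomputable def scaledCount {n : ℕ} (k : ℕ) (A : Set (Fin n → ℝ)) : ℕ :=
  (A ∩ {x | (k : ℝ) • x ∈ intLattice n}).ncard

theorem finite_inter_scaled {n k : ℕ} (hk : 0 < k) {A : Set (Fin n → ℝ)}
    (hA : Bornology.IsBounded A) : (A ∩ {x | (k : ℝ) • x ∈ intLattice n}).Finite := by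
  have hk' : (k : ℝ) ≠ 0 := by positivity
  refine Set.Finite.of_injOn (f := fun x => (k : ℝ) • x) (t := ((k : ℝ) • A) ∩ intLattice n) ?_
    (smul_right_injective _ hk').injOn (finite_inter_intLattice (hA.smul₀ (k : ℝ)))
  rintro x ⟨hx, hx'⟩
  exact ⟨Set.smul_mem_smul_set hx, hx'⟩

theorem scaledCount_eq {n k : ℕ} (hk : 0 < k) (A : Set (Fin n → ℝ)) :
    scaledCount k A = (((k : ℝ) • A) ∩ intLattice n).ncard := by
  have hk' : (k : ℝ) ≠ 0 := by positivity
  rw [scaledCount, ← Set.ncard_image_of_injective _ (smul_right_injective (Fin n → ℝ) hk')]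
  congr 1
  ext y
  constructor
  · rintro ⟨x, ⟨hx, hx'⟩, rfl⟩
    exact ⟨Set.smul_mem_smul_set hx, hx'⟩
  · rintro ⟨⟨x, hx, rfl⟩, hy⟩
    exact ⟨x, ⟨hx, hy⟩, rfl⟩

/-- The group of barycentric coordinate vectors, of any integral total weight, that describe
lattice points with respect to the points `v i`: the lattice points of the cone over `v`. -/
def coneGroup {ι : Type*} [Fintype ι] {n : ℕ} (v : ι → Fin n → ℝ) : AddSubgroup (ι → ℝ) where
  carrier := {c | ∑ i, c i • v i ∈ intLattice n ∧ ∃ z : ℤ, ∑ i, c i = z}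
  zero_mem' := ⟨by simpa using zero_mem_intLattice, 0, by simp⟩
  add_mem' := by
    rintro a b ⟨ha, x, hx⟩ ⟨hb, y, hy⟩
    refine ⟨?_, x + y, ?_⟩
    · simpa [add_smul, Finset.sum_add_distrib] using add_mem_intLattice ha hb
    · simp [Finset.sum_add_distrib, hx, hy]
  neg_mem' := by
    rintro a ⟨ha, x, hx⟩
    refine ⟨?_, -x, ?_⟩
    · simpa using neg_mem_intLattice ha
    · simp [hx]

section Simplex

variable {ι : Type*} [Fintype ι] {n : ℕ} {v : ι → Fin n → ℝ}

theorem mem_coneGroup {c : ι → ℝ} :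
    c ∈ coneGroup v ↔ ∑ i, c i • v i ∈ intLattice n ∧ ∃ z : ℤ, ∑ i, c i = z := Iff.rfl

theorem single_two_mem_coneGroup [DecidableEq ι] (hv : ∀ i, (2 : ℝ) • v i ∈ intLattice n) (i : ι) :
    Pi.single i (2 : ℝ) ∈ coneGroup v := by
  refine ⟨?_, 2, by simp⟩
  convert hv i using 1
  rw [Finset.sum_eq_single i (fun j _ hj => by simp [hj]) (by simp)]
  simp

theorem eq_of_sum_smul_eq (hv : AffineIndependent ℝ v) {c d : ι → ℝ}
    (h1 : ∑ i, c i • v i = ∑ i, d i • v i) (h2 : ∑ i, c i = ∑ i, d i) : c = d := by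
  have := affineIndependent_iff.1 hv Finset.univ (fun i => c i - d i)
    (by simp [h2]) (by simp [sub_smul, h1])
  ext i
  have := this i (Finset.mem_univ i)
  linarith

theorem finite_coneGroup_box (hv : AffineIndependent ℝ v) :
    {c | c ∈ coneGroup v ∧ ∀ i, 0 ≤ c i ∧ c i < 2}.Finite := by
  have hK : IsCompact ((fun c : ι → ℝ => ∑ i, c i • v i) '' Set.univ.pi fun _ => Set.Icc 0 2) :=
    (isCompact_univ_pi fun _ => isCompact_Icc).image (by fun_prop)
  refine Set.Finite.of_injOn (f := fun c => (∑ i, c i • v i, ∑ i, c i))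
    (t := (((fun c : ι → ℝ => ∑ i, c i • v i) '' Set.univ.pi fun _ => Set.Icc 0 2) ∩
      intLattice n) ×ˢ ((fun z : ℤ => (z : ℝ)) '' Set.Icc 0 (2 * Fintype.card ι))) ?_ ?_ ?_
  · rintro c ⟨⟨h1, z, hz⟩, h2⟩
    refine ⟨⟨⟨c, fun i _ => ⟨(h2 i).1, (h2 i).2.le⟩, rfl⟩, h1⟩, z, ⟨?_, ?_⟩, hz.symm⟩
    · have : 0 ≤ ∑ i, c i := Finset.sum_nonneg fun i _ => (h2 i).1
      rw [hz] at this; exact_mod_cast this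
    · have : ∑ i, c i ≤ ∑ i : ι, (2 : ℝ) := Finset.sum_le_sum fun i _ => (h2 i).2.le
      rw [hz] at this
      simp at this
      have h3 : (z : ℝ) ≤ ((2 * Fintype.card ι : ℤ) : ℝ) := by push_cast; linarith
      exact_mod_cast h3
  · intro c _ d _ h
    exact eq_of_sum_smul_eq hv (Prod.ext_iff.1 h).1 (Prod.ext_iff.1 h).2
  · exact (finite_inter_intLattice hK.isBounded).prod ((Set.finite_Icc _ _).image _)

/-- Taking `p` to be `0 ≤ ·` or `0 < ·` gives the closed simplex or its relative interior. -/
theorem scaledCount_simplex (hv : AffineIndependent ℝ v) {k : ℕ} (hk : 0 < k) (p : ℝ → Prop)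
    (hp : ∀ a x : ℝ, 0 < a → (p (a * x) ↔ p x)) :
    scaledCount k {x | ∃ w : ι → ℝ, (∀ i, p (w i)) ∧ ∑ i, w i = 1 ∧ ∑ i, w i • v i = x} =
      {c | c ∈ coneGroup v ∧ (∀ i, p (c i)) ∧ ∑ i, c i = (k : ℝ)}.ncard := by
  have hk' : (0 : ℝ) < k := by positivity
  rw [scaledCount]
  rw [← Set.InjOn.ncard_image (f := fun c : ι → ℝ => (k : ℝ)⁻¹ • ∑ i, c i • v i)
    (s := {c | c ∈ coneGroup v ∧ (∀ i, p (c i)) ∧ ∑ i, c i = (k : ℝ)})]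
  · congr 1
    ext x
    constructor
    · rintro ⟨⟨w, hw, hw1, rfl⟩, hx⟩
      refine ⟨fun i => k * w i, ⟨⟨?_, k, ?_⟩, fun i => (hp _ _ hk').2 (hw i), ?_⟩, ?_⟩
      · simpa [mul_smul, ← Finset.smul_sum] using hx
      · simp [← Finset.mul_sum, hw1]
      · simp [← Finset.mul_sum, hw1]
      · simp [mul_smul, ← Finset.smul_sum, hk'.ne']
    · rintro ⟨c, ⟨⟨h1, -⟩, h2, h3⟩, rfl⟩
      refine ⟨⟨fun i => (k : ℝ)⁻¹ * c i, fun i => (hp _ _ (by positivity)).2 (h2 i), ?_, ?_⟩, ?_⟩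
      · simp [← Finset.mul_sum, h3, hk'.ne']
      · simp [mul_smul, ← Finset.smul_sum]
      · simpa [hk'.ne'] using h1
  · rintro c ⟨-, -, hc⟩ d ⟨-, -, hd⟩ h
    exact eq_of_sum_smul_eq hv (smul_right_injective _ (inv_ne_zero hk'.ne') h) (hc.trans hd.symm)

theorem coneGroup_box_height {c : ι → ℝ}
    (hc : c ∈ {c | c ∈ coneGroup v ∧ ∀ i, 0 ≤ c i ∧ c i < 2}) :
    ∃ h : ℕ, h ≤ 2 * Fintype.card ι ∧ ∑ i, c i = h := by
  obtain ⟨⟨-, z, hz⟩, h2⟩ := hc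
  have h0 : 0 ≤ ∑ i, c i := Finset.sum_nonneg fun i _ => (h2 i).1
  rw [hz] at h0
  have h0' : 0 ≤ z := by exact_mod_cast h0
  lift z to ℕ using h0'
  refine ⟨z, ?_, by simpa using hz⟩
  have : ∑ i, c i ≤ ∑ i : ι, (2 : ℝ) := Finset.sum_le_sum fun i _ => (h2 i).2.le
  rw [hz] at this
  simp at this
  have h3 : (z : ℝ) ≤ ((2 * Fintype.card ι : ℕ) : ℝ) := by push_cast; linarith
  exact_mod_cast h3

end Simplex

/-- Counting and reciprocity for segments: a closed segment and the open segment have `β k + γ` and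
`β k - γ` points. -/
theorem exists_segment_counts {v : Fin 2 → Fin 2 → ℝ} (hv : AffineIndependent ℝ v)
    (h2 : ∀ i, (2 : ℝ) • v i ∈ intLattice 2) (r : ℕ) :
    ∃ β γ : ℝ, (r = 0 → γ = 1) ∧ ∀ k : ℕ, 0 < k → k % 2 = r →
      (scaledCount k (segment ℝ (v 0) (v 1)) : ℝ) = β * k + γ ∧
      (scaledCount k (openSegment ℝ (v 0) (v 1)) : ℝ) = β * k - γ := by
  classical
  have hB := finite_coneGroup_box hv
  choose! h hh1 hh2 using fun c => coneGroup_box_height (v := v) (c := c)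
  refine ⟨∑ π ∈ hB.toFinset with h π % 2 = r, 1 / 2, ∑ π ∈ hB.toFinset with h π % 2 = r,
    (1 - h π / 2 : ℝ), ?_, fun k hk hkr => ⟨?_, ?_⟩⟩
  -- among the heights of even parity below `4`, only height `0` contributes to the constant term
  · rintro rfl
    have h00 : (0 : Fin 2 → ℝ) ∈ {c | c ∈ coneGroup v ∧ ∀ i, 0 ≤ c i ∧ c i < 2} :=
      ⟨zero_mem _, by simp⟩
    have h0 : h 0 = 0 := by
      have := hh2 0 h00
      simp only [Pi.zero_apply, Finset.sum_const_zero] at this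
      exact_mod_cast this.symm
    rw [Finset.sum_eq_single 0]
    · simp [h0]
    · intro π hπ hπ0
      rw [Finset.mem_filter, Set.Finite.mem_toFinset] at hπ
      obtain ⟨hπ, he⟩ := hπ
      have hs := hh2 π hπ
      have hlt : ∑ i, π i < 4 := by
        rw [Fin.sum_univ_two]; linarith [(hπ.2 0).2, (hπ.2 1).2]
      rw [hs] at hlt
      have hlt' : h π < 4 := by exact_mod_cast hlt
      have hne : h π ≠ 0 := by
        intro h0
        rw [h0, Nat.cast_zero, Finset.sum_eq_zero_iff_of_nonneg fun i _ => (hπ.2 i).1] at hs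
        exact hπ0 (funext fun i => hs i (Finset.mem_univ i))
      have : h π = 2 := by omega
      rw [this]; norm_num
    · intro hn
      exact absurd (Finset.mem_filter.2 ⟨hB.mem_toFinset.2 h00, by simp [h0]⟩) hn
  · have hset : segment ℝ (v 0) (v 1) =
        {x | ∃ w : Fin 2 → ℝ, (∀ i, 0 ≤ w i) ∧ ∑ i, w i = 1 ∧ ∑ i, w i • v i = x} := by
      ext x
      constructor
      · rintro ⟨a, b, ha, hb, hab, rfl⟩
        exact ⟨![a, b], by simp [Fin.forall_fin_two, ha, hb], by simpa using hab, by simp⟩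
      · rintro ⟨w, hw, hw1, rfl⟩
        exact ⟨w 0, w 1, hw 0, hw 1, by simpa using hw1, by simp⟩
    rw [hset, scaledCount_simplex hv hk _ fun a x ha => mul_nonneg_iff_of_pos_left ha,
      ncard_closed_cone_slice (fun i => single_two_mem_coneGroup h2 i) hB, Finset.sum_mul,
      ← Finset.sum_add_distrib, Nat.cast_sum, Finset.sum_filter]
    refine Finset.sum_congr rfl fun π hπ => ?_
    rw [Set.Finite.mem_toFinset] at hπ
    have := hh1 π hπ
    rw [hh2 π hπ, ncard_fiber_fin_two (by simpa using this) hk, hkr]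
    split_ifs <;> ring
  · have hset : openSegment ℝ (v 0) (v 1) =
        {x | ∃ w : Fin 2 → ℝ, (∀ i, 0 < w i) ∧ ∑ i, w i = 1 ∧ ∑ i, w i • v i = x} := by
      ext x
      constructor
      · rintro ⟨a, b, ha, hb, hab, rfl⟩
        exact ⟨![a, b], by simp [Fin.forall_fin_two, ha, hb], by simpa using hab, by simp⟩
      · rintro ⟨w, hw, hw1, rfl⟩
        exact ⟨w 0, w 1, hw 0, hw 1, by simpa using hw1, by simp⟩
    rw [hset, scaledCount_simplex hv hk _ fun a x ha => mul_pos_iff_of_pos_left ha,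
      ncard_open_cone_slice (fun i => single_two_mem_coneGroup h2 i) hB, Finset.sum_mul,
      ← Finset.sum_sub_distrib, Nat.cast_sum, Finset.sum_filter]
    refine Finset.sum_congr rfl fun π hπ => ?_
    rw [Set.Finite.mem_toFinset] at hπ
    have := hh1 π hπ
    rw [Fintype.card_fin] at this ⊢
    have hc : (2 * (2 : ℕ) - ∑ i, π i : ℝ) = ((4 - h π : ℕ) : ℝ) := by
      rw [hh2 π hπ, Nat.cast_sub (by omega)]; norm_num
    rw [hc, ncard_fiber_fin_two (by omega) hk, hkr, Nat.cast_sub (by omega),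
      show (4 - h π) % 2 = h π % 2 by omega]
    split_ifs
    · push_cast; ring
    · ring

/-- Counting and reciprocity for triangles: replacing `k` by `-k` exchanges the polynomials of the
closed triangle and of its interior. -/
theorem exists_triangle_counts (b : AffineBasis (Fin 3) ℝ (Fin 2 → ℝ))
    (h2 : ∀ i, (2 : ℝ) • b i ∈ intLattice 2) (r : ℕ) :
    ∃ α β γ : ℝ, (r = 0 → γ = 1) ∧ ∀ k : ℕ, 0 < k → k % 2 = r →
      (scaledCount k (convexHull ℝ (Set.range b)) : ℝ) = α * k ^ 2 + β * k + γ ∧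
      (scaledCount k (interior (convexHull ℝ (Set.range b))) : ℝ) = α * k ^ 2 - β * k + γ := by
  classical
  have hv := b.ind
  have hB := finite_coneGroup_box hv
  choose! h hh1 hh2 using fun c => coneGroup_box_height (v := b) (c := c)
  have hset : ∀ p : ℝ → Prop, {x | ∀ i, p (b.coord i x)} =
      {x | ∃ w : Fin 3 → ℝ, (∀ i, p (w i)) ∧ ∑ i, w i = 1 ∧ ∑ i, w i • b i = x} := by
    intro p
    ext x
    constructor
    · intro hx
      exact ⟨fun i => b.coord i x, hx, b.sum_coord_apply_eq_one x,
        b.linear_combination_coord_eq_self x⟩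
    · rintro ⟨w, hw, hw1, rfl⟩ i
      have := eq_of_sum_smul_eq hv (c := fun i => b.coord i (∑ i, w i • b i)) (d := w)
        (b.linear_combination_coord_eq_self _) ((b.sum_coord_apply_eq_one _).trans hw1.symm)
      have := congrFun this i
      rw [this]
      exact hw i
  refine ⟨∑ π ∈ hB.toFinset with h π % 2 = r, 1 / 8,
    ∑ π ∈ hB.toFinset with h π % 2 = r, (3 - h π : ℝ) / 4,
    ∑ π ∈ hB.toFinset with h π % 2 = r, ((h π - 2 : ℝ) * (h π - 4) / 8),
    ?_, fun k hk hkr => ⟨?_, ?_⟩⟩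
  -- the constant term vanishes at the heights `2` and `4`, and only `π = 0` has height `0`
  · rintro rfl
    have h00 : (0 : Fin 3 → ℝ) ∈ {c | c ∈ coneGroup b ∧ ∀ i, 0 ≤ c i ∧ c i < 2} :=
      ⟨zero_mem _, by simp⟩
    have h0 : h 0 = 0 := by
      have := hh2 0 h00
      simp only [Pi.zero_apply, Finset.sum_const_zero] at this
      exact_mod_cast this.symm
    rw [Finset.sum_eq_single 0]
    · simp [h0]; norm_num
    · intro π hπ hπ0
      rw [Finset.mem_filter, Set.Finite.mem_toFinset] at hπ
      obtain ⟨hπ, he⟩ := hπ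
      have hs := hh2 π hπ
      have hlt : ∑ i, π i < 6 := by
        rw [Fin.sum_univ_three]; linarith [(hπ.2 0).2, (hπ.2 1).2, (hπ.2 2).2]
      rw [hs] at hlt
      have hlt' : h π < 6 := by exact_mod_cast hlt
      have hne : h π ≠ 0 := by
        intro h0
        rw [h0, Nat.cast_zero, Finset.sum_eq_zero_iff_of_nonneg fun i _ => (hπ.2 i).1] at hs
        exact hπ0 (funext fun i => hs i (Finset.mem_univ i))
      have : h π = 2 ∨ h π = 4 := by omega
      rcases this with h | h <;> rw [h] <;> norm_num
    · intro hn
      exact absurd (Finset.mem_filter.2 ⟨hB.mem_toFinset.2 h00, by simp [h0]⟩) hn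
  · rw [b.convexHull_eq_nonneg_coord, hset (fun t => 0 ≤ t),
      scaledCount_simplex hv hk _ fun a x ha => mul_nonneg_iff_of_pos_left ha,
      ncard_closed_cone_slice (fun i => single_two_mem_coneGroup h2 i) hB, Finset.sum_mul,
      Finset.sum_mul, ← Finset.sum_add_distrib, ← Finset.sum_add_distrib, Nat.cast_sum,
      Finset.sum_filter]
    refine Finset.sum_congr rfl fun π hπ => ?_
    rw [Set.Finite.mem_toFinset] at hπ
    have := hh1 π hπ
    rw [hh2 π hπ, ncard_fiber_fin_three (by simpa using this) hk, hkr]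
    split_ifs <;> ring
  · rw [b.interior_convexHull, hset (fun t => 0 < t),
      scaledCount_simplex hv hk _ fun a x ha => mul_pos_iff_of_pos_left ha,
      ncard_open_cone_slice (fun i => single_two_mem_coneGroup h2 i) hB, Finset.sum_mul,
      Finset.sum_mul, ← Finset.sum_sub_distrib, ← Finset.sum_add_distrib, Nat.cast_sum,
      Finset.sum_filter]
    refine Finset.sum_congr rfl fun π hπ => ?_
    rw [Set.Finite.mem_toFinset] at hπ
    have := hh1 π hπ
    rw [Fintype.card_fin] at this ⊢
    have hc : (2 * (3 : ℕ) - ∑ i, π i : ℝ) = ((6 - h π : ℕ) : ℝ) := by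
      rw [hh2 π hπ, Nat.cast_sub (by omega)]; norm_num
    rw [hc, ncard_fiber_fin_three (by omega) hk, hkr, Nat.cast_sub (by omega),
      show (6 - h π) % 2 = h π % 2 by omega]
    split_ifs
    · push_cast; ring
    · ring

/-! ### Cutting a plane polygon along a diagonal -/

/-- The linear functional `x ↦ det (u, x)`, whose kernel is the line spanned by `u` if
`u ≠ 0`. -/
noncomputable def detForm (u : Fin 2 → ℝ) : (Fin 2 → ℝ) →L[ℝ] ℝ :=
  u 0 • ContinuousLinearMap.proj (R := ℝ) (φ := fun _ : Fin 2 => ℝ) 1 -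
    u 1 • ContinuousLinearMap.proj (R := ℝ) (φ := fun _ : Fin 2 => ℝ) 0

@[simp]
theorem detForm_apply (u x : Fin 2 → ℝ) : detForm u x = u 0 * x 1 - u 1 * x 0 := by
  simp [detForm]

theorem detForm_sub_eq {a c : Fin 2 → ℝ} : detForm (c - a) c = detForm (c - a) a := by
  simp; ring

theorem exists_eq_add_smul_of_detForm_eq {a c x : Fin 2 → ℝ} (hac : a ≠ c)
    (h : detForm (c - a) x = detForm (c - a) a) : ∃ s : ℝ, x = a + s • (c - a) := by
  simp only [detForm_apply, Pi.sub_apply] at h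
  by_cases h0 : c 0 - a 0 = 0
  · have h1 : c 1 - a 1 ≠ 0 := by
      intro h1
      refine hac (funext fun i => ?_)
      fin_cases i
      · simpa using (sub_eq_zero.1 h0).symm
      · simpa using (sub_eq_zero.1 h1).symm
    refine ⟨(x 1 - a 1) / (c 1 - a 1), funext fun i => ?_⟩
    rw [h0] at h
    have : x 0 = a 0 := by
      have : (c 1 - a 1) * x 0 = (c 1 - a 1) * a 0 := by linarith
      exact mul_left_cancel₀ h1 this
    fin_cases i
    · simp [this, h0]
    · simp [h1]
  · refine ⟨(x 0 - a 0) / (c 0 - a 0), funext fun i => ?_⟩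
    fin_cases i
    · simp [h0]
    · simp
      field_simp
      linarith

section Plane

variable {E : Type*} [AddCommGroup E] [Module ℝ E]

theorem mem_openSegment_of_eq_add_smul {x y z : E} {s : ℝ} (h0 : 0 < s) (h1 : s < 1)
    (h : z = x + s • (y - x)) : z ∈ openSegment ℝ x y := by
  rw [openSegment_eq_image']
  exact ⟨s, ⟨h0, h1⟩, h.symm⟩

/-- On the line through two extreme points of a set, the set lies between these two points. -/
theorem mem_Icc_of_extremePoints {P : Set E} {a c x : E} (ha : a ∈ P.extremePoints ℝ)
    (hc : c ∈ P.extremePoints ℝ) (hac : a ≠ c) (hx : x ∈ P) {s : ℝ} (hs : x = a + s • (c - a)) :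
    0 ≤ s ∧ s ≤ 1 := by
  have hca : c - a ≠ 0 := sub_ne_zero.2 hac.symm
  constructor
  · by_contra! h
    have : a ∈ openSegment ℝ x c := by
      refine mem_openSegment_of_eq_add_smul (s := -s / (1 - s))
        (div_pos (by linarith) (by linarith))
        ((div_lt_one (by linarith)).2 (by linarith)) ?_
      have h1 : (1 - s) ≠ 0 := by linarith
      have : c - (a + s • (c - a)) = (1 - s) • (c - a) := by module
      rw [hs, this, smul_smul, div_mul_cancel₀ _ h1]
      module
    exact hac.symm ((mem_extremePoints.1 ha).2 x hx c hc.1 this).2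
  · by_contra! h
    have : c ∈ openSegment ℝ a x := by
      refine mem_openSegment_of_eq_add_smul (s := 1 / s) (by positivity)
        ((div_lt_one (by linarith)).2 (by linarith)) ?_
      have h1 : s ≠ 0 := by linarith
      rw [hs, add_sub_cancel_left, smul_smul, one_div_mul_cancel h1]
      module
    exact hac ((mem_extremePoints.1 hc).2 a ha.1 x hx this).1

theorem exists_mem_openSegment_eq (f : E →ₗ[ℝ] ℝ) {x y : E} {t : ℝ} (hx : t < f x)
    (hy : f y < t) : ∃ w ∈ openSegment ℝ x y, f w = t := by
  refine ⟨x + ((f x - t) / (f x - f y)) • (y - x), mem_openSegment_of_eq_add_smul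
    (div_pos (by linarith) (by linarith)) ((div_lt_one (by linarith)).2 (by linarith)) rfl, ?_⟩
  have : f x - f y ≠ 0 := by linarith
  simp only [map_add, map_smul, map_sub, smul_eq_mul]
  field_simp
  ring

end Plane

section Cut

variable {T : Set (Fin 2 → ℝ)} {a c : Fin 2 → ℝ}

theorem inter_line_eq_segment (ha : a ∈ (convexHull ℝ T).extremePoints ℝ)
    (hc : c ∈ (convexHull ℝ T).extremePoints ℝ) (hac : a ≠ c) {x : Fin 2 → ℝ}
    (hx : x ∈ convexHull ℝ T) (h : detForm (c - a) x = detForm (c - a) a) :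
    x ∈ segment ℝ a c := by
  obtain ⟨s, hs⟩ := exists_eq_add_smul_of_detForm_eq hac h
  rw [segment_eq_image']
  exact ⟨s, mem_Icc_of_extremePoints ha hc hac hx hs, hs.symm⟩

/-- Cutting a polygon along the diagonal `[a, c]`: the part of the polygon on one side of the
diagonal is the convex hull of the vertices on this side. The functional `f` is `± det (c - a, ·)`
so that the lemma applies to both sides. -/
theorem convexHull_inter_halfPlane (f : (Fin 2 → ℝ) →ₗ[ℝ] ℝ) {t : ℝ} (haT : a ∈ T) (hcT : c ∈ T)
    (hfa : f a = t) (hfc : f c = t)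
    (hline : ∀ x ∈ convexHull ℝ T, f x = t → x ∈ segment ℝ a c) :
    convexHull ℝ (T ∩ {x | t ≤ f x}) = convexHull ℝ T ∩ {x | t ≤ f x} := by
  apply Set.Subset.antisymm
  · refine convexHull_min (Set.inter_subset_inter_left _ (subset_convexHull ℝ T)) ?_
    exact (convex_convexHull ℝ T).inter (convex_halfSpace_ge f.isLinear t)
  · rintro x ⟨hx, hxt⟩
    have hxt : t ≤ f x := hxt
    have hU : T = (T ∩ {x | t ≤ f x}) ∪ (T ∩ {x | f x ≤ t}) := by
      rw [← Set.inter_union_distrib_left, eq_comm, Set.inter_eq_left]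
      intro y _
      exact le_total t (f y)
    have hsub : T ∩ {x | t ≤ f x} ⊆ T := Set.inter_subset_left
    have hsub' : T ∩ {x | f x ≤ t} ⊆ T := Set.inter_subset_left
    have ha1 : a ∈ T ∩ {x | t ≤ f x} := ⟨haT, hfa.ge⟩
    have hc1 : c ∈ T ∩ {x | t ≤ f x} := ⟨hcT, hfc.ge⟩
    have hseg : segment ℝ a c ⊆ convexHull ℝ (T ∩ {x | t ≤ f x}) :=
      segment_subset_convexHull ha1 hc1
    rw [hU, convexHull_union (Set.nonempty_of_mem ha1)
      (show (T ∩ {x | f x ≤ t}).Nonempty from ⟨a, haT, hfa.le⟩), mem_convexJoin] at hx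
    obtain ⟨y, hy, z, hz, hxyz⟩ := hx
    have hzt : f z ≤ t := convexHull_min (s := T ∩ {x | f x ≤ t}) (t := {x | f x ≤ t})
      Set.inter_subset_right (convex_halfSpace_le f.isLinear t) hz
    have hyt : t ≤ f y := convexHull_min (s := T ∩ {x | t ≤ f x}) (t := {x | t ≤ f x})
      Set.inter_subset_right (convex_halfSpace_ge f.isLinear t) hy
    have hyT := convexHull_mono hsub hy
    have hzT := convexHull_mono hsub' hz
    rcases hzt.eq_or_lt with hzt | hzt
    · exact (convex_convexHull ℝ _).segment_subset hy (hseg (hline z hzT hzt)) hxyz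
    rcases hyt.eq_or_lt with hyt | hyt
    · rw [segment_eq_image'] at hxyz
      obtain ⟨s, hs, rfl⟩ := hxyz
      simp only [map_add, map_smul, map_sub, smul_eq_mul, ← hyt] at hxt
      have : s = 0 := by nlinarith [hs.1]
      simpa [this] using hy
    · obtain ⟨w, hw, hwt⟩ := exists_mem_openSegment_eq f hyt hzt
      have hwT := (convex_convexHull ℝ T).openSegment_subset hyT hzT hw
      have hw1 := hseg (hline w hwT hwt)
      rw [openSegment_eq_image'] at hw
      rw [segment_eq_image'] at hxyz
      obtain ⟨s, hs, rfl⟩ := hxyz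
      obtain ⟨r, hr, rfl⟩ := hw
      simp only [map_add, map_smul, map_sub, smul_eq_mul] at hxt hwt
      have hsr : s ≤ r := by
        have : s * (f y - f z) ≤ r * (f y - f z) := by linarith
        exact le_of_mul_le_mul_right this (by linarith)
      refine (convex_convexHull ℝ _).segment_subset hy hw1 ?_
      rw [segment_eq_image']
      refine ⟨s / r, ⟨div_nonneg hs.1 hr.1.le, (div_le_one hr.1).2 hsr⟩, ?_⟩
      simp only [add_sub_cancel_left, smul_smul, div_mul_cancel₀ s hr.1.ne']

/-- The open diagonal between two vertices with vertices on both sides is interior. -/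
theorem openSegment_subset_interior_of_diagonal (ha : a ∈ (convexHull ℝ T).extremePoints ℝ)
    (hc : c ∈ (convexHull ℝ T).extremePoints ℝ) (hac : a ≠ c)
    (hint : (interior (convexHull ℝ T)).Nonempty) {b d : Fin 2 → ℝ} (hb : b ∈ T) (hd : d ∈ T)
    (hbt : detForm (c - a) a < detForm (c - a) b) (hdt : detForm (c - a) d < detForm (c - a) a) :
    openSegment ℝ a c ⊆ interior (convexHull ℝ T) := by
  have hconv := convex_convexHull ℝ T
  -- some interior point lies on the line through `a` and `c`
  obtain ⟨w, hw, hwt⟩ : ∃ w ∈ interior (convexHull ℝ T), detForm (c - a) w = detForm (c - a) a := by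
    obtain ⟨x, hx⟩ := hint
    rcases lt_trichotomy (detForm (c - a) x) (detForm (c - a) a) with h | h | h
    · obtain ⟨w, hw, hwt⟩ := exists_mem_openSegment_eq (detForm (c - a)).toLinearMap hbt h
      exact ⟨w, hconv.openSegment_self_interior_subset_interior (subset_convexHull ℝ T hb) hx hw,
        hwt⟩
    · exact ⟨x, hx, h⟩
    · obtain ⟨w, hw, hwt⟩ := exists_mem_openSegment_eq (detForm (c - a)).toLinearMap h hdt
      exact ⟨w, hconv.openSegment_interior_self_subset_interior hx (subset_convexHull ℝ T hd) hw,
        hwt⟩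
  obtain ⟨s, hs⟩ := exists_eq_add_smul_of_detForm_eq hac hwt
  have hs01 := mem_Icc_of_extremePoints ha hc hac (interior_subset hw) hs
  intro z hz
  rw [openSegment_eq_image'] at hz
  obtain ⟨r, hr, rfl⟩ := hz
  rcases lt_trichotomy r s with h | h | h
  · refine hconv.openSegment_self_interior_subset_interior ha.1 hw ?_
    refine mem_openSegment_of_eq_add_smul (s := r / s) (div_pos hr.1 (hr.1.trans h))
      ((div_lt_one (hr.1.trans h)).2 h) ?_
    simp only [hs, add_sub_cancel_left, smul_smul, div_mul_cancel₀ r (hr.1.trans h).ne']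
  · dsimp only
    rw [h, ← hs]
    exact hw
  · refine hconv.openSegment_interior_self_subset_interior hw hc.1 ?_
    have h1 : 0 < 1 - s := by linarith [hr.2]
    refine mem_openSegment_of_eq_add_smul (s := (r - s) / (1 - s)) (div_pos (by linarith) h1)
      ((div_lt_one h1).2 (by linarith [hr.2])) ?_
    have : c - (a + s • (c - a)) = (1 - s) • (c - a) := by module
    simp only [hs]
    rw [this, smul_smul, div_mul_cancel₀ _ h1.ne']
    module

theorem interior_halfPlane_ge {f : (Fin 2 → ℝ) →L[ℝ] ℝ} (hf : f ≠ 0) (t : ℝ) :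
    interior {x | t ≤ f x} = {x | t < f x} := by
  have := (f.isOpenMap_of_ne_zero hf).preimage_interior_eq_interior_preimage f.continuous
    (Set.Ici t)
  rw [interior_Ici] at this
  exact this.symm

end Cut

/-! ### Counts for polygons by induction on the vertices -/

theorem scaledCount_union_add_inter {n k : ℕ} (hk : 0 < k) {A B : Set (Fin n → ℝ)}
    (hA : Bornology.IsBounded A) (hB : Bornology.IsBounded B) :
    scaledCount k (A ∪ B) + scaledCount k (A ∩ B) = scaledCount k A + scaledCount k B := by
  rw [scaledCount, scaledCount, Set.union_inter_distrib_right, Set.inter_inter_distrib_right]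
  exact Set.ncard_union_add_ncard_inter _ _ (finite_inter_scaled hk hA) (finite_inter_scaled hk hB)

theorem scaledCount_union {n k : ℕ} (hk : 0 < k) {A B : Set (Fin n → ℝ)}
    (hA : Bornology.IsBounded A) (hB : Bornology.IsBounded B) (h : Disjoint A B) :
    scaledCount k (A ∪ B) = scaledCount k A + scaledCount k B := by
  rw [← scaledCount_union_add_inter hk hA hB, h.inter_eq]
  simp [scaledCount]

theorem convexHull_extremePoints_convexHull {T : Set (Fin 2 → ℝ)} (hT : T.Finite) :
    convexHull ℝ ((convexHull ℝ T).extremePoints ℝ) = convexHull ℝ T := by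
  have h := closure_convexHull_extremePoints (hT.isCompact_convexHull ℝ) (convex_convexHull ℝ T)
  rwa [((hT.subset extremePoints_convexHull_subset).isClosed_convexHull ℝ).closure_eq] at h

theorem detForm_ne_zero_of_extremePoints {P : Set (Fin 2 → ℝ)} {a c x : Fin 2 → ℝ}
    (ha : a ∈ P.extremePoints ℝ) (hc : c ∈ P.extremePoints ℝ) (hx : x ∈ P.extremePoints ℝ)
    (hac : a ≠ c) (hax : a ≠ x) (hcx : c ≠ x) :
    detForm (c - a) x - detForm (c - a) a ≠ 0 := by
  intro h
  obtain ⟨s, hs⟩ := exists_eq_add_smul_of_detForm_eq hac (sub_eq_zero.1 h)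
  obtain ⟨h0, h1⟩ := mem_Icc_of_extremePoints ha hc hac hx.1 hs
  have h0' : s ≠ 0 := by rintro rfl; exact hax (by simpa using hs.symm)
  have h1' : s ≠ 1 := by rintro rfl; exact hcx (by simpa using hs.symm)
  exact hax ((mem_extremePoints.1 hx).2 a ha.1 c hc.1 (mem_openSegment_of_eq_add_smul
    (lt_of_le_of_ne h0 h0'.symm) (lt_of_le_of_ne h1 h1') hs)).1

/-- A polygon with at least four vertices has a diagonal with vertices on both sides: seen from a
vertex `a`, one of any three other vertices lies between the other two, by comparing the signs of
the three determinants. -/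
theorem exists_diagonal {P : Set (Fin 2 → ℝ)} (hfin : (P.extremePoints ℝ).Finite)
    (hcard : 3 < (P.extremePoints ℝ).ncard) :
    ∃ a ∈ P.extremePoints ℝ, ∃ c ∈ P.extremePoints ℝ, a ≠ c ∧ ∃ b ∈ P.extremePoints ℝ,
      ∃ d ∈ P.extremePoints ℝ, detForm (c - a) a < detForm (c - a) b ∧
        detForm (c - a) d < detForm (c - a) a := by
  obtain ⟨a, ha⟩ := Set.nonempty_of_ncard_ne_zero (s := P.extremePoints ℝ) (by omega)
  have h2 : 2 < (P.extremePoints ℝ \ {a}).ncard := by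
    rw [Set.ncard_sdiff_singleton_of_mem ha]; omega
  obtain ⟨b, c, d, ⟨hb, hba⟩, ⟨hc, hca⟩, ⟨hd, hda⟩, hbc, hbd, hcd⟩ :=
    (Set.two_lt_ncard_iff hfin.sdiff).1 h2
  refine ⟨a, ha, ?_⟩
  have key : ∀ x ∈ P.extremePoints ℝ, x ≠ a → ∀ y ∈ P.extremePoints ℝ, ∀ z ∈ P.extremePoints ℝ,
      (detForm (x - a) y - detForm (x - a) a) * (detForm (x - a) z - detForm (x - a) a) < 0 →
      ∃ c ∈ P.extremePoints ℝ, a ≠ c ∧ ∃ b ∈ P.extremePoints ℝ,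
      ∃ d ∈ P.extremePoints ℝ, detForm (c - a) a < detForm (c - a) b ∧
        detForm (c - a) d < detForm (c - a) a := by
    intro x hx hxa y hy z hz h
    rcases mul_neg_iff.1 h with ⟨h1, h2⟩ | ⟨h1, h2⟩
    · exact ⟨x, hx, hxa.symm, y, hy, z, hz, by linarith, by linarith⟩
    · exact ⟨x, hx, hxa.symm, z, hz, y, hy, by linarith, by linarith⟩
  have hba : b ≠ a := hba
  have hca : c ≠ a := hca
  have hda : d ≠ a := hda
  have hp := detForm_ne_zero_of_extremePoints ha hb hc hba.symm hca.symm hbc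
  have hq := detForm_ne_zero_of_extremePoints ha hb hd hba.symm hda.symm hbd
  have hs := detForm_ne_zero_of_extremePoints ha hc hd hca.symm hda.symm hcd
  by_contra hno
  have h1 := fun h => hno (key b hb hba c hc d hd h)
  have h2 := fun h => hno (key c hc hca b hb d hd h)
  have h3 := fun h => hno (key d hd hda b hb c hc h)
  set p := detForm (b - a) c - detForm (b - a) a with hpdef
  set q := detForm (b - a) d - detForm (b - a) a with hqdef
  set s := detForm (c - a) d - detForm (c - a) a with hsdef
  have e1 : detForm (c - a) b - detForm (c - a) a = -p := by
    rw [hpdef]; simp; ring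
  have e2 : detForm (d - a) b - detForm (d - a) a = -q := by
    rw [hqdef]; simp; ring
  have e3 : detForm (d - a) c - detForm (d - a) a = -s := by
    rw [hsdef]; simp; ring
  rw [e1] at h2
  rw [e2, e3] at h3
  have h1' : 0 < p * q := lt_of_le_of_ne (not_lt.1 h1) (mul_ne_zero hp hq).symm
  have h2' : p * s < 0 := lt_of_le_of_ne (by linarith [not_lt.1 h2]) (mul_ne_zero hp hs)
  have h3' : 0 < q * s := lt_of_le_of_ne (by linarith [not_lt.1 h3]) (mul_ne_zero hq hs).symm
  have := mul_pos h1' h3'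
  -- if no vertex lay between the other two, then `p q > 0`, `p s < 0` and `q s > 0`
  have h4 : p * q * (q * s) = q ^ 2 * (p * s) := by ring
  rw [h4] at this
  nlinarith [sq_nonneg q]

/-- A polygon with at most three vertices is a triangle. -/
theorem exists_affineBasis_of_ncard_le {T : Set (Fin 2 → ℝ)} (hT : T.Finite) (hcard : T.ncard ≤ 3)
    (hint : (interior (convexHull ℝ T)).Nonempty) :
    ∃ b : AffineBasis (Fin 3) ℝ (Fin 2 → ℝ), Set.range b = T := by
  have hspan := interior_convexHull_nonempty_iff_affineSpan_eq_top.1 hint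
  have hne : T.Nonempty := by
    obtain ⟨x, hx⟩ := hint
    exact convexHull_nonempty_iff.1 ⟨x, interior_subset hx⟩
  have := hT.fintype
  have : Nonempty T := hne.to_subtype
  obtain ⟨e⟩ : Nonempty (T ↪ Fin 3) := by
    apply Function.Embedding.nonempty_of_card_le
    rwa [Fintype.card_fin, ← Nat.card_eq_fintype_card, Nat.card_coe_set_eq]
  let g : Fin 3 → T := Function.invFun e
  have hg : Function.Surjective g := Function.invFun_surjective e.injective
  let v : Fin 3 → Fin 2 → ℝ := fun i => g i
  have hv : Set.range v = T := by
    have : v = Subtype.val ∘ g := rfl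
    rw [this, Set.range_comp, hg.range_eq, Set.image_univ, Subtype.range_coe]
  have hind : AffineIndependent ℝ v := by
    rw [affineIndependent_iff_finrank_vectorSpan_eq ℝ v (n := 2) (by simp), hv,
      ← direction_affineSpan, hspan, AffineSubspace.direction_top, finrank_top]
    simp
  exact ⟨⟨v, hind, by rw [hv, hspan]⟩, hv⟩

/-- Counting and reciprocity for half-integral polygons. -/
theorem exists_polygon_counts (n : ℕ) : ∀ T : Set (Fin 2 → ℝ), T.Finite → T.ncard = n →
    (∀ x ∈ T, (2 : ℝ) • x ∈ intLattice 2) → (interior (convexHull ℝ T)).Nonempty → ∀ r : ℕ,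
    ∃ α β γ : ℝ, (r = 0 → γ = 1) ∧ ∀ k : ℕ, 0 < k → k % 2 = r →
      (scaledCount k (convexHull ℝ T) : ℝ) = α * k ^ 2 + β * k + γ ∧
      (scaledCount k (interior (convexHull ℝ T)) : ℝ) = α * k ^ 2 - β * k + γ := by
  induction n using Nat.strong_induction_on with
  | _ n ih =>
  intro S hS hSn hS2 hint r
  set T := (convexHull ℝ S).extremePoints ℝ with hTdef
  have hTS : T ⊆ S := extremePoints_convexHull_subset
  have hhull : convexHull ℝ T = convexHull ℝ S := convexHull_extremePoints_convexHull hS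
  rw [← hhull] at hint ⊢
  have hT : T.Finite := hS.subset hTS
  have hTn : T.ncard ≤ n := hSn ▸ Set.ncard_le_ncard hTS hS
  have hT2 : ∀ x ∈ T, (2 : ℝ) • x ∈ intLattice 2 := fun x hx => hS2 x (hTS hx)
  have hText : (convexHull ℝ T).extremePoints ℝ = T := by rw [hhull]
  rcases Nat.lt_or_ge 3 T.ncard with hcard | hcard
  · obtain ⟨a, ha, c, hc, hac, b, hb, d, hd, hbt, hdt⟩ :=
      exists_diagonal (P := convexHull ℝ T) (by rwa [hText]) (by rwa [hText])
    have haT : a ∈ T := hText ▸ ha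
    have hcT : c ∈ T := hText ▸ hc
    have hbT : b ∈ T := hText ▸ hb
    have hdT : d ∈ T := hText ▸ hd
    set f := detForm (c - a) with hf
    set t := f a with ht
    have hfc : f c = t := detForm_sub_eq
    have hf0 : f ≠ 0 := by rintro h; simp [ht, h] at hbt
    have hseg_of_line : ∀ x ∈ convexHull ℝ T, f x = t → x ∈ segment ℝ a c := fun x hx h =>
      inter_line_eq_segment ha hc hac hx h
    have hopen := openSegment_subset_interior_of_diagonal ha hc hac hint hbT hdT hbt hdt
    have hsegT : segment ℝ a c ⊆ convexHull ℝ T :=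
      (convex_convexHull ℝ T).segment_subset ha.1 hc.1
    have hsegf : ∀ x ∈ segment ℝ a c, f x = t := by
      rintro x hx
      rw [segment_eq_image'] at hx
      obtain ⟨s, -, rfl⟩ := hx
      simp only [map_add, map_smul, map_sub, hfc, ← ht]; simp
    set P := convexHull ℝ T with hP
    set T₁ := T ∩ {x | t ≤ f x} with hT1
    set T₂ := T ∩ {x | -t ≤ (-f) x} with hT2'
    have h1 : convexHull ℝ T₁ = P ∩ {x | t ≤ f x} :=
      convexHull_inter_halfPlane f.toLinearMap haT hcT rfl hfc hseg_of_line
    have h2 : convexHull ℝ T₂ = P ∩ {x | -t ≤ (-f) x} :=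
      convexHull_inter_halfPlane (-f).toLinearMap haT hcT rfl (by simpa using hfc)
        fun x hx h => hseg_of_line x hx (by simpa using h)
    have hT1n : T₁.ncard < n := lt_of_lt_of_le (Set.ncard_lt_ncard
      ⟨Set.inter_subset_left, fun h => absurd hdt (not_lt.2 (h hdT).2)⟩ hT) hTn
    have hT2n : T₂.ncard < n := lt_of_lt_of_le (Set.ncard_lt_ncard
      ⟨Set.inter_subset_left, fun h => by
        have : -t ≤ (-f) b := (h hbT).2
        simp only [neg_apply] at this
        linarith⟩ hT) hTn
    have hi1 : interior (convexHull ℝ T₁) = interior P ∩ {x | t < f x} := by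
      rw [h1, interior_inter, interior_halfPlane_ge hf0]
    have hi2 : interior (convexHull ℝ T₂) = interior P ∩ {x | -t < (-f) x} := by
      rw [h2, interior_inter, interior_halfPlane_ge (neg_ne_zero.2 hf0)]
    -- moving from the interior point `midpoint a c` halfway towards a vertex stays in the interior
    have hne : ∀ x ∈ T, ∃ y ∈ interior P, ∃ s : ℝ, 0 < s ∧ f y - t = s * (f x - t) := by
      intro x hx
      have hm : midpoint ℝ a c ∈ openSegment ℝ a c := midpoint_mem_openSegment a c
      have hm' := hopen hm
      refine ⟨midpoint ℝ (midpoint ℝ a c) x,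
        (convex_convexHull ℝ T).openSegment_interior_self_subset_interior hm'
          (subset_convexHull ℝ T hx) (midpoint_mem_openSegment _ _), 1 / 2, by norm_num, ?_⟩
      have := hsegf _ (openSegment_subset_segment ℝ _ _ hm)
      rw [midpoint_eq_smul_add ℝ (midpoint ℝ a c) x, map_smul, map_add, this, smul_eq_mul,
        invOf_eq_inv]
      ring
    have hn1 : (interior (convexHull ℝ T₁)).Nonempty := by
      obtain ⟨y, hy, s, hs, hys⟩ := hne b hbT
      refine hi1 ▸ ⟨y, hy, ?_⟩
      have := mul_pos hs (sub_pos.2 hbt)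
      show t < f y
      linarith
    have hn2 : (interior (convexHull ℝ T₂)).Nonempty := by
      obtain ⟨y, hy, s, hs, hys⟩ := hne d hdT
      refine hi2 ▸ ⟨y, hy, ?_⟩
      have := mul_pos hs (sub_pos.2 hdt)
      show -t < -f y
      linarith
    have hU : convexHull ℝ T₁ ∪ convexHull ℝ T₂ = P := by
      rw [h1, h2, ← Set.inter_union_distrib_left, Set.inter_eq_left]
      intro x _
      rcases le_total t (f x) with h | h
      · exact Or.inl h
      · exact Or.inr (show -t ≤ -f x by linarith)
    have hI : convexHull ℝ T₁ ∩ convexHull ℝ T₂ = segment ℝ a c := by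
      rw [h1, h2]
      ext x
      constructor
      · rintro ⟨⟨hx, hx1⟩, -, hx2⟩
        have hx2 : -t ≤ -f x := hx2
        exact hseg_of_line x hx (le_antisymm (by linarith) hx1)
      · intro hx
        have := hsegf x hx
        exact ⟨⟨hsegT hx, this.ge⟩, hsegT hx, show -t ≤ -f x by linarith⟩
    have hIU : interior (convexHull ℝ T₁) ∪ interior (convexHull ℝ T₂) ∪ openSegment ℝ a c =
        interior P := by
      rw [hi1, hi2]
      apply Set.Subset.antisymm
      · exact Set.union_subset (Set.union_subset Set.inter_subset_left Set.inter_subset_left) hopen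
      · intro x hx
        rcases lt_trichotomy (f x) t with h | h | h
        · exact Or.inl (Or.inr ⟨hx, show -t < -f x by linarith⟩)
        · refine Or.inr (mem_openSegment_of_ne_left_right ?_ ?_
            (hseg_of_line x (interior_subset hx) h))
          · rintro rfl
            exact Set.disjoint_left.1 (disjoint_interior_extremePoints P) hx ha
          · rintro rfl
            exact Set.disjoint_left.1 (disjoint_interior_extremePoints P) hx hc
        · exact Or.inl (Or.inl ⟨hx, h⟩)
    have hD1 : Disjoint (interior (convexHull ℝ T₁)) (interior (convexHull ℝ T₂)) := by
      rw [hi1, hi2, Set.disjoint_left]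
      rintro x ⟨-, h⟩ ⟨-, h'⟩
      have h : t < f x := h
      have h' : -t < -f x := h'
      linarith
    have hD2 : Disjoint (interior (convexHull ℝ T₁) ∪ interior (convexHull ℝ T₂))
        (openSegment ℝ a c) := by
      rw [hi1, hi2, Set.disjoint_left]
      rintro x (⟨-, h⟩ | ⟨-, h⟩) hx
      · have h : t < f x := h
        exact h.ne' (hsegf x (openSegment_subset_segment ℝ _ _ hx))
      · have h : -t < -f x := h
        have := hsegf x (openSegment_subset_segment ℝ _ _ hx)
        linarith
    have hb0 : Bornology.IsBounded P := (hT.isCompact_convexHull ℝ).isBounded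
    have hb1 : Bornology.IsBounded (convexHull ℝ T₁) := hb0.subset (h1 ▸ Set.inter_subset_left)
    have hb2 : Bornology.IsBounded (convexHull ℝ T₂) := hb0.subset (h2 ▸ Set.inter_subset_left)
    obtain ⟨α₁, β₁, γ₁, hr1, hk1⟩ := ih _ hT1n T₁ (hT.subset Set.inter_subset_left) rfl
      (fun x hx => hT2 x hx.1) hn1 r
    obtain ⟨α₂, β₂, γ₂, hr2, hk2⟩ := ih _ hT2n T₂ (hT.subset Set.inter_subset_left) rfl
      (fun x hx => hT2 x hx.1) hn2 r
    obtain ⟨β, γ, hr, hk⟩ := exists_segment_counts (affineIndependent_of_ne ℝ hac)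
      (by simp [Fin.forall_fin_two, hT2 a haT, hT2 c hcT]) r
    refine ⟨α₁ + α₂, β₁ + β₂ - β, γ₁ + γ₂ - γ, fun h => by rw [hr1 h, hr2 h, hr h]; norm_num,
      fun k hk0 hkr => ?_⟩
    obtain ⟨e1, e1'⟩ := hk1 k hk0 hkr
    obtain ⟨e2, e2'⟩ := hk2 k hk0 hkr
    obtain ⟨e, e'⟩ := hk k hk0 hkr
    simp only [Matrix.cons_val_zero, Matrix.cons_val_one] at e e'
    constructor
    · have := scaledCount_union_add_inter hk0 hb1 hb2
      rw [hU, hI] at this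
      have : (scaledCount k P : ℝ) + scaledCount k (segment ℝ a c) =
        scaledCount k (convexHull ℝ T₁) + scaledCount k (convexHull ℝ T₂) := by exact_mod_cast this
      rw [e, e1, e2] at this
      linarith
    · have hb3 := hb1.subset (interior_subset (s := convexHull ℝ T₁))
      have hb4 := hb2.subset (interior_subset (s := convexHull ℝ T₂))
      rw [← hIU, scaledCount_union hk0 (hb3.union hb4)
        (hb0.subset ((openSegment_subset_segment ℝ a c).trans hsegT)) hD2,
        scaledCount_union hk0 hb3 hb4 hD1]
      push_cast
      rw [e1', e2', e']
      ring
  · obtain ⟨b, hb⟩ := exists_affineBasis_of_ncard_le hT hcard hint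
    rw [← hb]
    exact exists_triangle_counts b (fun i => hT2 _ (hb ▸ Set.mem_range_self i)) r

/-! ### Area and boundary counts -/

theorem latticeCount_smul {n k : ℕ} (hk : 0 < k) (P : Set (Fin n → ℝ)) :
    latticeCount ((k : ℝ) • P) = scaledCount k P := (scaledCount_eq hk P).symm

theorem boundaryCount_smul {n k : ℕ} (hk : 0 < k) (P : Set (Fin n → ℝ)) :
    boundaryCount ((k : ℝ) • P) = scaledCount k (frontier P) := by
  have hk' : (k : ℝ) ≠ 0 := by positivity
  have : frontier ((k : ℝ) • P) = (k : ℝ) • frontier P := by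
    rw [← Set.image_smul, ← Set.image_smul]
    exact ((Homeomorph.smulOfNeZero (k : ℝ) hk').image_frontier P).symm
  rw [boundaryCount, this, scaledCount_eq hk]

theorem scaledCount_interior_add_frontier {n k : ℕ} (hk : 0 < k) {P : Set (Fin n → ℝ)}
    (hc : IsClosed P) (hb : Bornology.IsBounded P) :
    scaledCount k (interior P) + scaledCount k (frontier P) = scaledCount k P := by
  rw [← scaledCount_union hk (hb.subset interior_subset) (hb.subset hc.frontier_subset)
    disjoint_interior_frontier]
  congr 1
  rw [← closure_eq_interior_union_frontier, hc.closure_eq]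

theorem latticeCount_eq_interior_add_boundary {n : ℕ} {P : Set (Fin n → ℝ)}
    (hc : IsClosed P) (hb : Bornology.IsBounded P) :
    latticeCount P = interiorCount P + boundaryCount P := by
  have h := scaledCount_interior_add_frontier one_pos hc hb
  simp only [scaledCount, Nat.cast_one, one_smul] at h
  exact h.symm

/-- Only the fact that `2 P` is a lattice polygon is extracted from the denominator being `2`; the
points of `T` need not be vertices. -/
theorem IsHalfIntegralPolygon.exists_vertices {P : Set (Fin 2 → ℝ)} (hP : IsHalfIntegralPolygon P) :
    ∃ T : Set (Fin 2 → ℝ), T.Finite ∧ (∀ x ∈ T, (2 : ℝ) • x ∈ intLattice 2) ∧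
      P = convexHull ℝ T := by
  have hne : {d : ℕ | 1 ≤ d ∧ IsLatticePolytope ((d : ℝ) • P)}.Nonempty := by
    by_contra h
    rw [Set.not_nonempty_iff_eq_empty] at h
    have := hP.2
    rw [denom, h, Nat.sInf_empty] at this
    omega
  have h2 := Nat.sInf_mem hne
  rw [show sInf {d : ℕ | 1 ≤ d ∧ IsLatticePolytope ((d : ℝ) • P)} = 2 from hP.2] at h2
  obtain ⟨-, ⟨S, hS, hSZ, hPS⟩, -⟩ := h2
  refine ⟨(2 : ℝ)⁻¹ • S, hS.smul_set, ?_, ?_⟩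
  · rintro _ ⟨x, hx, rfl⟩
    simpa using hSZ hx
  · rw [convexHull_smul, ← hPS]
    simp

theorem tendsto_scaledCount_div_sq {P : Set (Fin 2 → ℝ)} (hc : IsClosed P)
    (hb : Bornology.IsBounded P) (hconv : Convex ℝ P) :
    Filter.Tendsto (fun k : ℕ => (scaledCount k P : ℝ) / k ^ 2) Filter.atTop
      (nhds (area P)) := by
  have h := tendsto_card_div_pow_atTop_volume P hb hc.measurableSet (hconv.addHaar_frontier volume)
  rw [area]
  refine h.congr' ?_
  filter_upwards [Filter.eventually_gt_atTop 0] with k hk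
  have hk' : (k : ℝ) ≠ 0 := by positivity
  rw [Fintype.card_fin, scaledCount, Nat.card_coe_set_eq]
  congr 4
  ext x
  rw [Set.mem_smul_set_iff_inv_smul_mem₀ (inv_ne_zero hk'), inv_inv, Set.mem_ofPred_eq]
  rw [SetLike.mem_coe, (Pi.basisFun ℝ (Fin 2)).mem_span_iff_repr_mem ℤ]
  simp only [Pi.basisFun_repr, intLattice, Set.mem_ofPred_eq, Set.mem_range]
  refine forall_congr' fun i => exists_congr fun z => ?_
  simp [eq_comm]

theorem nonpos_of_forall_mul_le {x C : ℝ} (r : ℕ) (hr : r < 2)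
    (h : ∀ k : ℕ, 0 < k → k % 2 = r → x * k ≤ C) : x ≤ 0 := by
  by_contra! hx
  obtain ⟨m, hm⟩ := exists_nat_gt (C / x)
  have h1 := h (2 * (m + 1) + r) (by omega) (by omega)
  rw [div_lt_iff₀ hx] at hm
  have : x * (m : ℝ) ≤ x * ((2 * (m + 1) + r : ℕ) : ℝ) := by
    apply mul_le_mul_of_nonneg_left _ hx.le
    exact_mod_cast (by omega : m ≤ 2 * (m + 1) + r)
  linarith

theorem leadingCoeff_eq_area {P : Set (Fin 2 → ℝ)} (hc : IsClosed P)
    (hb : Bornology.IsBounded P) (hconv : Convex ℝ P) {α β γ : ℝ} {r : ℕ} (hr : r < 2)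
    (h : ∀ k : ℕ, 0 < k → k % 2 = r → (scaledCount k P : ℝ) = α * k ^ 2 + β * k + γ) :
    α = area P := by
  have hsub : Filter.Tendsto (fun m : ℕ => 2 * (m + 1) + r) Filter.atTop Filter.atTop :=
    Filter.tendsto_atTop_mono (fun m => by simp only [id]; omega) Filter.tendsto_id
  have h1 := (tendsto_scaledCount_div_sq hc hb hconv).comp hsub
  have hinv : Filter.Tendsto (fun m : ℕ => (((2 * (m + 1) + r : ℕ) : ℝ))⁻¹) Filter.atTop
      (nhds 0) := tendsto_inv_atTop_nhds_zero_nat.comp hsub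
  have h2 : Filter.Tendsto (fun m : ℕ => α + β * (((2 * (m + 1) + r : ℕ) : ℝ))⁻¹ +
      γ * (((2 * (m + 1) + r : ℕ) : ℝ))⁻¹ ^ 2) Filter.atTop (nhds (α + β * 0 + γ * 0 ^ 2)) :=
    ((hinv.const_mul β).const_add α).add ((hinv.pow 2).const_mul γ)
  have h3 : α + β * 0 + γ * 0 ^ 2 = α := by ring
  rw [h3] at h2
  refine tendsto_nhds_unique (h2.congr fun m => ?_) h1
  have hpos : ((2 * (m + 1) + r : ℕ) : ℝ) ≠ 0 := by
    exact_mod_cast (by omega : 2 * (m + 1) + r ≠ 0)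
  simp only [Function.comp]
  rw [h _ (by omega) (by omega)]
  field_simp

section Polygon

variable {T : Set (Fin 2 → ℝ)}

/-- The leading coefficient is the area, and by reciprocity the linear coefficient is half the
slope of the boundary count. -/
theorem polygon_counts (hT : T.Finite) (hT2 : ∀ x ∈ T, (2 : ℝ) • x ∈ intLattice 2)
    (hint : (interior (convexHull ℝ T)).Nonempty) {r : ℕ} (hr : r < 2) :
    ∃ β γ : ℝ, (r = 0 → γ = 1) ∧ ∀ k : ℕ, 0 < k → k % 2 = r →
      (scaledCount k (convexHull ℝ T) : ℝ) = area (convexHull ℝ T) * k ^ 2 + β * k + γ ∧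
      (scaledCount k (frontier (convexHull ℝ T)) : ℝ) = 2 * β * k := by
  obtain ⟨α, β, γ, hγ, h⟩ := exists_polygon_counts _ T hT rfl hT2 hint r
  have hcpt := hT.isCompact_convexHull ℝ
  have hα := leadingCoeff_eq_area hcpt.isClosed hcpt.isBounded (convex_convexHull ℝ T) hr
    fun k hk hkr => (h k hk hkr).1
  subst hα
  refine ⟨β, γ, hγ, fun k hk hkr => ⟨(h k hk hkr).1, ?_⟩⟩
  obtain ⟨h1, h2⟩ := h k hk hkr
  have h3 := scaledCount_interior_add_frontier hk hcpt.isClosed hcpt.isBounded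
  have h4 : (scaledCount k (interior (convexHull ℝ T)) : ℝ) +
    scaledCount k (frontier (convexHull ℝ T)) = scaledCount k (convexHull ℝ T) := by
    exact_mod_cast h3
  linarith

end Polygon

/-! ### Counts on edges and the faces of a polygon -/

/-- A lattice point `z` of a convex set `A` makes the count monotone, through the injection
`x ↦ (k x + z) / (k + 1)`. -/
theorem scaledCount_le_succ {n k : ℕ} (hk : 0 < k) {A : Set (Fin n → ℝ)} (hA : Convex ℝ A)
    (hb : Bornology.IsBounded A) {z : Fin n → ℝ} (hz : z ∈ A) (hzZ : z ∈ intLattice n) :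
    scaledCount k A ≤ scaledCount (k + 1) A := by
  have hk1 : ((k : ℝ) + 1) ≠ 0 := by positivity
  have hk0 : (k : ℝ) ≠ 0 := by positivity
  refine Set.ncard_le_ncard_of_injOn (fun x => ((k : ℝ) + 1)⁻¹ • ((k : ℝ) • x + z)) ?_ ?_
    (finite_inter_scaled (Nat.succ_pos k) hb)
  · rintro x ⟨hx, hxZ⟩
    refine ⟨?_, ?_⟩
    · have := hA hx hz (a := (k : ℝ) / (k + 1)) (b := 1 / (k + 1)) (by positivity) (by positivity)
        (by field_simp)
      convert this using 1
      rw [smul_add, smul_smul]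
      congr 2 <;> ring
    · show ((k + 1 : ℕ) : ℝ) • (((k : ℝ) + 1)⁻¹ • ((k : ℝ) • x + z)) ∈ intLattice n
      rw [Nat.cast_add_one, smul_smul, mul_inv_cancel₀ hk1, one_smul]
      exact add_mem_intLattice hxZ hzZ
  · intro x _ y _ h
    have := smul_right_injective _ (inv_ne_zero hk1) h
    exact smul_right_injective _ hk0 (add_right_cancel this)

/-- The counts of a half-integral segment grow at least as fast along even `k` as along odd `k`,
and equally fast exactly when the segment has a lattice point. -/
theorem exists_segment_slopes {a c : Fin 2 → ℝ} (hac : a ≠ c)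
    (ha : (2 : ℝ) • a ∈ intLattice 2) (hc : (2 : ℝ) • c ∈ intLattice 2) :
    ∃ β₁ γ₁ β₀ γ₀ : ℝ,
      (∀ k : ℕ, 0 < k → k % 2 = 1 → (scaledCount k (segment ℝ a c) : ℝ) = β₁ * k + γ₁) ∧
      (∀ k : ℕ, 0 < k → k % 2 = 0 → (scaledCount k (segment ℝ a c) : ℝ) = β₀ * k + γ₀) ∧
      β₁ ≤ β₀ ∧ (β₁ = β₀ ↔ (segment ℝ a c ∩ intLattice 2).Nonempty) := by
  have hv2 : ∀ i, (2 : ℝ) • (![a, c] : Fin 2 → Fin 2 → ℝ) i ∈ intLattice 2 := by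
    simp [Fin.forall_fin_two, ha, hc]
  obtain ⟨β₁, γ₁, -, h1⟩ := exists_segment_counts (affineIndependent_of_ne ℝ hac) hv2 1
  obtain ⟨β₀, γ₀, hγ₀, h0⟩ := exists_segment_counts (affineIndependent_of_ne ℝ hac) hv2 0
  simp only [Matrix.cons_val_zero, Matrix.cons_val_one] at h1 h0
  have hb : Bornology.IsBounded (segment ℝ a c) := by
    rw [← convexHull_pair]
    exact ((Set.toFinite {a, c}).isCompact_convexHull ℝ).isBounded
  have hconv := convex_segment (𝕜 := ℝ) a c
  have key : (segment ℝ a c ∩ intLattice 2).Nonempty → β₁ = β₀ := by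
    rintro ⟨z, hz, hzZ⟩
    have hmono := fun k (hk : 0 < k) => scaledCount_le_succ hk hconv hb hz hzZ
    apply le_antisymm
    · refine sub_nonpos.1 (nonpos_of_forall_mul_le (C := β₀ + γ₀ - γ₁) 1 (by norm_num)
        fun k hk hkr => ?_)
      have e := hmono k hk
      have e' : (scaledCount k (segment ℝ a c) : ℝ) ≤ scaledCount (k + 1) (segment ℝ a c) := by
        exact_mod_cast e
      rw [(h1 k hk hkr).1, (h0 (k + 1) (by omega) (by omega)).1] at e'
      push_cast at e'
      linarith
    · refine sub_nonpos.1 (nonpos_of_forall_mul_le (C := β₁ + γ₁ - γ₀) 0 (by norm_num)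
        fun k hk hkr => ?_)
      have e := hmono k hk
      have e' : (scaledCount k (segment ℝ a c) : ℝ) ≤ scaledCount (k + 1) (segment ℝ a c) := by
        exact_mod_cast e
      rw [(h0 k hk hkr).1, (h1 (k + 1) (by omega) (by omega)).1] at e'
      push_cast at e'
      linarith
  -- without a lattice point, reciprocity at `k = 1` forces `β₁ + γ₁ = 0 = β₁ - γ₁`, while the two
  -- end points are counted for `k = 2`
  have key' : ¬ (segment ℝ a c ∩ intLattice 2).Nonempty → β₁ < β₀ := by
    intro hemp
    rw [Set.not_nonempty_iff_eq_empty] at hemp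
    have e1 := h1 1 one_pos rfl
    have hz : scaledCount 1 (segment ℝ a c) = 0 := by
      simp only [scaledCount, Nat.cast_one, one_smul]
      exact (congrArg Set.ncard hemp).trans (Set.ncard_empty _)
    have hz' : scaledCount 1 (openSegment ℝ a c) = 0 := by
      simp only [scaledCount, Nat.cast_one, one_smul]
      have : openSegment ℝ a c ∩ intLattice 2 = ∅ := by
        rw [← Set.subset_empty_iff, ← hemp]
        exact Set.inter_subset_inter_left _ (openSegment_subset_segment ℝ a c)
      exact (congrArg Set.ncard this).trans (Set.ncard_empty _)
    rw [hz, hz'] at e1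
    have e2 := (h0 2 two_pos rfl).1
    have hge : 2 ≤ scaledCount 2 (segment ℝ a c) := by
      refine (Set.ncard_pair hac).ge.trans ?_
      refine Set.ncard_le_ncard ?_ (finite_inter_scaled two_pos hb)
      rintro x (rfl | rfl)
      · exact ⟨left_mem_segment ℝ _ _, by simpa using ha⟩
      · exact ⟨right_mem_segment ℝ _ _, by simpa using hc⟩
    have hge' : (2 : ℝ) ≤ scaledCount 2 (segment ℝ a c) := by exact_mod_cast hge
    rw [e2, hγ₀ rfl] at hge'
    push_cast at e1 hge'
    linarith [e1.1, e1.2]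
  refine ⟨β₁, γ₁, β₀, γ₀, fun k hk hkr => (h1 k hk hkr).1, fun k hk hkr => (h0 k hk hkr).1, ?_, ?_⟩
  · by_cases h : (segment ℝ a c ∩ intLattice 2).Nonempty
    · exact (key h).le
    · exact (key' h).le
  · refine ⟨fun h => ?_, key⟩
    by_contra hn
    exact (key' hn).ne h

section Edges

variable {T : Set (Fin 2 → ℝ)} {e e' : Set (Fin 2 → ℝ)}

/-- In a set spanning a line, every difference of two points is a multiple of any nonzero one. -/
theorem exists_eq_add_smul_of_finrank_vectorSpan (h : Module.finrank ℝ (vectorSpan ℝ e) = 1)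
    {a c x : Fin 2 → ℝ} (ha : a ∈ e) (hc : c ∈ e) (hac : a ≠ c) (hx : x ∈ e) :
    ∃ s : ℝ, x = a + s • (c - a) := by
  have hca : (⟨c - a, vsub_mem_vectorSpan ℝ hc ha⟩ : vectorSpan ℝ e) ≠ 0 := by
    intro h0
    exact hac (sub_eq_zero.1 (congrArg Subtype.val h0)).symm
  obtain ⟨s, hs⟩ := (finrank_eq_one_iff_of_nonzero' _ hca).1 h ⟨x - a, vsub_mem_vectorSpan ℝ hx ha⟩
  refine ⟨s, ?_⟩
  have := congrArg Subtype.val hs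
  simp only [SetLike.val_smul] at this
  rw [this]; abel

theorem IsEdge.eq_segment (hT : T.Finite) (he : IsEdge (convexHull ℝ T) e) :
    ∃ a ∈ T, ∃ c ∈ T, a ≠ c ∧ e = segment ℝ a c := by
  obtain ⟨hexp, hrank⟩ := he
  have hcpt : IsCompact e := hexp.isCompact (hT.isCompact_convexHull ℝ)
  have hconv : Convex ℝ e := hexp.convex (convex_convexHull ℝ T)
  have hsub : e.extremePoints ℝ ⊆ T :=
    hexp.isExtreme.extremePoints_subset_extremePoints.trans extremePoints_convexHull_subset
  have hhull : convexHull ℝ (e.extremePoints ℝ) = e := by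
    have h := closure_convexHull_extremePoints hcpt hconv
    rwa [((hT.subset hsub).isClosed_convexHull ℝ).closure_eq] at h
  have hnt : (e.extremePoints ℝ).Nontrivial := by
    by_contra h
    rw [Set.not_nontrivial_iff] at h
    have h1 : vectorSpan ℝ e = ⊥ := by
      rcases h.eq_empty_or_singleton with h | ⟨x, h⟩
      · rw [← hhull, h]; simp
      · rw [← hhull, h]; simp
    rw [h1, finrank_bot] at hrank
    exact zero_ne_one hrank
  obtain ⟨a, ha, c, hc, hac⟩ := hnt
  refine ⟨a, hsub ha, c, hsub hc, hac, Set.Subset.antisymm (fun x hx => ?_)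
    (hconv.segment_subset ha.1 hc.1)⟩
  obtain ⟨s, hs⟩ := exists_eq_add_smul_of_finrank_vectorSpan hrank ha.1 hc.1 hac hx
  rw [segment_eq_image']
  exact ⟨s, mem_Icc_of_extremePoints ha hc hac hx hs, hs.symm⟩

theorem finite_setOf_isEdge (hT : T.Finite) : {e | IsEdge (convexHull ℝ T) e}.Finite := by
  refine ((hT.prod hT).image fun p => segment ℝ p.1 p.2).subset fun e he => ?_
  obtain ⟨a, ha, c, hc, -, rfl⟩ := IsEdge.eq_segment hT he
  exact ⟨(a, c), ⟨ha, hc⟩, rfl⟩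

/-- The functional exposing `e` takes its maximum at two points of `e'`, so on all of `e'`. -/
theorem IsEdge.subset_of_mem {P : Set (Fin 2 → ℝ)} (he : IsEdge P e) (he' : IsEdge P e')
    {x y : Fin 2 → ℝ} (hx : x ∈ e) (hx' : x ∈ e') (hy : y ∈ e) (hy' : y ∈ e') (hxy : x ≠ y) :
    e' ⊆ e := by
  obtain ⟨l, rfl⟩ := he.1 ⟨x, hx⟩
  intro z hz
  obtain ⟨s, hs⟩ := exists_eq_add_smul_of_finrank_vectorSpan he'.2 hx' hy' hxy hz
  have hlxy : l x = l y := le_antisymm (hy.2 x hx.1) (hx.2 y hy.1)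
  have hlz : l z = l x := by rw [hs]; simp [hlxy]
  exact ⟨he'.1.subset hz, fun w hw => hlz ▸ hx.2 w hw⟩

theorem IsEdge.inter_subsingleton {P : Set (Fin 2 → ℝ)} (he : IsEdge P e) (he' : IsEdge P e')
    (hne : e ≠ e') : (e ∩ e').Subsingleton := by
  rintro x ⟨hx, hx'⟩ y ⟨hy, hy'⟩
  by_contra hxy
  exact hne (Set.Subset.antisymm (he'.subset_of_mem he hx' hx hy' hy hxy)
    (he.subset_of_mem he' hx hx' hy hy' hxy))

theorem IsEdge.subset_frontier {P : Set (Fin 2 → ℝ)} (hspan : affineSpan ℝ P = ⊤)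
    (he : IsEdge P e) : e ⊆ frontier P := by
  intro x hx
  refine ⟨subset_closure (he.1.subset hx), fun hxi => ?_⟩
  obtain ⟨l, rfl⟩ := he.1 ⟨x, hx⟩
  have hmax : IsLocalMax l x := by
    filter_upwards [mem_interior_iff_mem_nhds.1 hxi] with y hy using hx.2 y hy
  have hl : l = 0 := hmax.hasFDerivAt_eq_zero l.hasFDerivAt
  subst hl
  have h2 := he.2
  have : {x | x ∈ P ∧ ∀ y ∈ P, (0 : (Fin 2 → ℝ) →L[ℝ] ℝ) y ≤ (0 : (Fin 2 → ℝ) →L[ℝ] ℝ) x} = P := by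
    ext; simp
  rw [this, ← direction_affineSpan, hspan, AffineSubspace.direction_top, finrank_top] at h2
  simp at h2

/-- A supporting functional at a boundary point exposes a face of dimension `1` or `0`. -/
theorem frontier_subset_edges (hT : T.Finite) (hint : (interior (convexHull ℝ T)).Nonempty) :
    frontier (convexHull ℝ T) ⊆ T ∪ ⋃ e ∈ {e | IsEdge (convexHull ℝ T) e}, e := by
  intro p hp
  have hconv := convex_convexHull ℝ T
  have hclosed := (hT.isCompact_convexHull ℝ).isClosed
  obtain ⟨g, hg⟩ := geometric_hahn_banach_open_point hconv.interior isOpen_interior hp.2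
  have hpP : p ∈ convexHull ℝ T := hclosed.frontier_subset hp
  have hle : ∀ y ∈ convexHull ℝ T, g y ≤ g p := by
    have hcl : convexHull ℝ T ⊆ closure (interior (convexHull ℝ T)) := by
      rw [hconv.closure_interior_eq_closure_of_nonempty_interior hint]
      exact subset_closure
    intro y hy
    have : closure (interior (convexHull ℝ T)) ⊆ {y | g y ≤ g p} :=
      closure_minimal (fun y hy => (hg y hy).le) (isClosed_le g.continuous continuous_const)
    exact this (hcl hy)
  set e := {x | x ∈ convexHull ℝ T ∧ ∀ y ∈ convexHull ℝ T, g y ≤ g x} with hedef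
  have hpe : p ∈ e := ⟨hpP, hle⟩
  have hexp : IsExposed ℝ (convexHull ℝ T) e := fun _ => ⟨g, rfl⟩
  by_cases hrank : Module.finrank ℝ (vectorSpan ℝ e) = 1
  · exact Or.inr (Set.mem_biUnion (show IsEdge (convexHull ℝ T) e from ⟨hexp, hrank⟩) hpe)
  · left
    have hg0 : g ≠ 0 := by
      rintro rfl
      obtain ⟨x, hx⟩ := hint
      exact lt_irrefl _ (hg x hx)
    have hker : vectorSpan ℝ e ≤ LinearMap.ker g.toLinearMap := by
      rw [vectorSpan, Submodule.span_le]
      rintro _ ⟨x, hx, y, hy, rfl⟩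
      have : g x = g y := le_antisymm (hy.2 x hx.1) (hx.2 y hy.1)
      simp [this]
    have hk1 : Module.finrank ℝ (LinearMap.ker g.toLinearMap) = 1 := by
      have h1 := LinearMap.finrank_range_add_finrank_ker g.toLinearMap
      have h2 : LinearMap.range g.toLinearMap = ⊤ := by
        apply LinearMap.range_eq_top.2
        apply LinearMap.surjective
        intro h
        exact hg0 (ContinuousLinearMap.coe_injective h)
      rw [h2, finrank_top] at h1
      simp at h1
      omega
    have h0 : Module.finrank ℝ (vectorSpan ℝ e) = 0 := by
      have := Submodule.finrank_mono hker
      omega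
    rw [Submodule.finrank_eq_zero, vectorSpan_eq_bot_iff_subsingleton] at h0
    have hes : e = {p} := h0.eq_singleton_of_mem hpe
    have hext : p ∈ (convexHull ℝ T).extremePoints ℝ := by
      rw [← isExtreme_singleton, ← hes]
      exact hexp.isExtreme
    exact extremePoints_convexHull_subset hext

end Edges

/-! ### Comparing boundary counts with edges -/

section Edges

variable {T : Set (Fin 2 → ℝ)}

/-- The points lying on two edges and those lying on none are finite in number, so they contribute
a bounded error. -/
theorem exists_bound_frontier_sub_edges (hT : T.Finite)
    (hint : (interior (convexHull ℝ T)).Nonempty) :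
    ∃ C : ℕ, ∀ k : ℕ, 0 < k →
      scaledCount k (frontier (convexHull ℝ T)) ≤
        ∑ e ∈ (finite_setOf_isEdge hT).toFinset, scaledCount k e + C ∧
      ∑ e ∈ (finite_setOf_isEdge hT).toFinset, scaledCount k e ≤
        scaledCount k (frontier (convexHull ℝ T)) + C := by
  classical
  have hspan : affineSpan ℝ (convexHull ℝ T) = ⊤ := by
    rw [affineSpan_convexHull]
    exact interior_convexHull_nonempty_iff_affineSpan_eq_top.1 hint
  have hcpt := hT.isCompact_convexHull ℝ
  set 𝓔 := (finite_setOf_isEdge hT).toFinset with h𝓔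
  have hmem : ∀ e, e ∈ 𝓔 ↔ IsEdge (convexHull ℝ T) e := fun e => by simp [h𝓔]
  -- the points that lie on two edges
  set N : Set (Fin 2 → ℝ) := ⋃ p ∈ 𝓔.offDiag, p.1 ∩ p.2 with hN
  have hNfin : N.Finite := by
    refine 𝓔.offDiag.finite_toSet.biUnion fun p hp => ?_
    rw [Finset.mem_coe, Finset.mem_offDiag] at hp
    exact (((hmem _).1 hp.1).inter_subsingleton ((hmem _).1 hp.2.1) hp.2.2).finite
  refine ⟨T.ncard + 𝓔.card * N.ncard, fun k hk => ⟨?_, ?_⟩⟩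
  · have hfr : frontier (convexHull ℝ T) ⊆ T ∪ ⋃ e ∈ 𝓔, e := by
      have := frontier_subset_edges hT hint
      simpa only [h𝓔, Set.Finite.mem_toFinset] using this
    have hbd : ∀ e ∈ 𝓔, Bornology.IsBounded e := fun e he =>
      hcpt.isBounded.subset ((hmem e).1 he).1.subset
    have hsub : frontier (convexHull ℝ T) ∩ {x | (k : ℝ) • x ∈ intLattice 2} ⊆
        T ∪ ⋃ e ∈ 𝓔, (e ∩ {x | (k : ℝ) • x ∈ intLattice 2}) := by
      rintro x ⟨hx, hxZ⟩
      rcases hfr hx with h | h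
      · exact Or.inl h
      · simp only [Set.mem_iUnion] at h
        obtain ⟨e, he, hxe⟩ := h
        exact Or.inr (Set.mem_biUnion he ⟨hxe, hxZ⟩)
    have hUfin : (⋃ e ∈ 𝓔, (e ∩ {x | (k : ℝ) • x ∈ intLattice 2})).Finite :=
      𝓔.finite_toSet.biUnion fun e he => finite_inter_scaled hk (hbd e he)
    have h1 := Set.ncard_le_ncard hsub (hT.union hUfin)
    have h2 := Set.ncard_union_le T (⋃ e ∈ 𝓔, (e ∩ {x | (k : ℝ) • x ∈ intLattice 2}))
    have h3 := Finset.set_ncard_biUnion_le 𝓔 fun e => e ∩ {x | (k : ℝ) • x ∈ intLattice 2}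
    simp only [scaledCount]
    omega
  · have hFfin := finite_inter_scaled hk (n := 2)
      (hcpt.isBounded.subset hcpt.isClosed.frontier_subset)
    -- away from `N` the edges are disjoint
    have hsum : ∑ e ∈ 𝓔, ((e ∩ {x | (k : ℝ) • x ∈ intLattice 2}) \ N).ncard ≤
        scaledCount k (frontier (convexHull ℝ T)) := by
      rw [scaledCount, Set.ncard_eq_toFinset_card _ hFfin]
      have hfe : ∀ e ∈ 𝓔, (e ∩ {x | (k : ℝ) • x ∈ intLattice 2}) \ N ⊆
          frontier (convexHull ℝ T) ∩ {x | (k : ℝ) • x ∈ intLattice 2} := fun e he x hx =>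
        ⟨((hmem e).1 he).subset_frontier hspan hx.1.1, hx.1.2⟩
      have : ∀ e ∈ 𝓔, ((e ∩ {x | (k : ℝ) • x ∈ intLattice 2}) \ N).ncard =
          (hFfin.toFinset.filter fun x => x ∈ (e ∩ {x | (k : ℝ) • x ∈ intLattice 2}) \ N).card := by
        intro e he
        rw [← Set.ncard_coe_finset]
        congr 1
        ext x
        simp only [Finset.coe_filter, Set.Finite.mem_toFinset, Set.mem_ofPred_eq]
        exact ⟨fun hx => ⟨hfe e he hx, hx⟩, fun hx => hx.2⟩
      rw [Finset.sum_congr rfl this, ← Finset.card_biUnion]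
      · exact Finset.card_le_card (Finset.biUnion_subset.2 fun e _ => Finset.filter_subset _ _)
      · intro e he e' he' hne
        rw [Function.onFun, Finset.disjoint_left]
        intro x hx hx'
        have h1 := (Finset.mem_filter.1 hx).2
        have h2 := (Finset.mem_filter.1 hx').2
        exact h1.2 (Set.mem_biUnion (x := (e, e')) (Finset.mem_offDiag.2 ⟨he, he', hne⟩)
          ⟨h1.1.1, h2.1.1⟩)
    have hle : ∑ e ∈ 𝓔, scaledCount k e ≤
        ∑ e ∈ 𝓔, (((e ∩ {x | (k : ℝ) • x ∈ intLattice 2}) \ N).ncard + N.ncard) := by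
      refine Finset.sum_le_sum fun e _ => ?_
      have := Set.ncard_le_ncard_sdiff_add_ncard (e ∩ {x | (k : ℝ) • x ∈ intLattice 2}) N hNfin
      exact this
    rw [Finset.sum_add_distrib, Finset.sum_const, smul_eq_mul] at hle
    omega

/-- `b(2P) = 2 b(P)` if and only if every edge of `P` has a lattice point. -/
theorem frontier_count_two_eq_iff (hT : T.Finite) (hT2 : ∀ x ∈ T, (2 : ℝ) • x ∈ intLattice 2)
    (hint : (interior (convexHull ℝ T)).Nonempty) :
    scaledCount 2 (frontier (convexHull ℝ T)) = 2 * scaledCount 1 (frontier (convexHull ℝ T)) ↔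
      ∀ e, IsEdge (convexHull ℝ T) e → (e ∩ intLattice 2).Nonempty := by
  obtain ⟨C, hC⟩ := exists_bound_frontier_sub_edges hT hint
  set 𝓔 := (finite_setOf_isEdge hT).toFinset with h𝓔
  have hmem : ∀ e, e ∈ 𝓔 ↔ IsEdge (convexHull ℝ T) e := fun e => by simp [h𝓔]
  have hslope : ∀ e, e ∈ 𝓔 → ∃ β₁ γ₁ β₀ γ₀ : ℝ,
      (∀ k : ℕ, 0 < k → k % 2 = 1 → (scaledCount k e : ℝ) = β₁ * k + γ₁) ∧
      (∀ k : ℕ, 0 < k → k % 2 = 0 → (scaledCount k e : ℝ) = β₀ * k + γ₀) ∧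
      β₁ ≤ β₀ ∧ (β₁ = β₀ ↔ (e ∩ intLattice 2).Nonempty) := by
    intro e he
    obtain ⟨a, ha, c, hc, hac, rfl⟩ := ((hmem e).1 he).eq_segment hT
    exact exists_segment_slopes hac (hT2 a ha) (hT2 c hc)
  choose! β₁ γ₁ β₀ γ₀ h1 h0 hle hiff using hslope
  -- the slope of the boundary count is the sum of the slopes of the edges
  have slope : ∀ (r : ℕ) (_ : r < 2) (β γ : Set (Fin 2 → ℝ) → ℝ) (B : ℝ),
      (∀ e ∈ 𝓔, ∀ k : ℕ, 0 < k → k % 2 = r → (scaledCount k e : ℝ) = β e * k + γ e) →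
      (∀ k : ℕ, 0 < k → k % 2 = r → (scaledCount k (frontier (convexHull ℝ T)) : ℝ) = B * k) →
      B = ∑ e ∈ 𝓔, β e := by
    intro r hr β γ B hβ hB
    have hs : ∀ k : ℕ, 0 < k → k % 2 = r → ((∑ e ∈ 𝓔, scaledCount k e : ℕ) : ℝ) =
        (∑ e ∈ 𝓔, β e) * k + ∑ e ∈ 𝓔, γ e := by
      intro k hk hkr
      rw [Nat.cast_sum, Finset.sum_mul, ← Finset.sum_add_distrib]
      exact Finset.sum_congr rfl fun e he => hβ e he k hk hkr
    apply le_antisymm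
    · refine sub_nonpos.1 (nonpos_of_forall_mul_le (C := C + ∑ e ∈ 𝓔, γ e) r hr
        fun k hk hkr => ?_)
      have h : (scaledCount k (frontier (convexHull ℝ T)) : ℝ) ≤
        ((∑ e ∈ 𝓔, scaledCount k e : ℕ) : ℝ) + C := by exact_mod_cast (hC k hk).1
      rw [hB k hk hkr, hs k hk hkr] at h
      linarith
    · refine sub_nonpos.1 (nonpos_of_forall_mul_le (C := C - ∑ e ∈ 𝓔, γ e) r hr
        fun k hk hkr => ?_)
      have h : ((∑ e ∈ 𝓔, scaledCount k e : ℕ) : ℝ) ≤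
        (scaledCount k (frontier (convexHull ℝ T)) : ℝ) + C := by exact_mod_cast (hC k hk).2
      rw [hB k hk hkr, hs k hk hkr] at h
      linarith
  obtain ⟨b₁, c₁, -, hb1⟩ := polygon_counts hT hT2 hint (r := 1) (by norm_num)
  obtain ⟨b₀, c₀, -, hb0⟩ := polygon_counts hT hT2 hint (r := 0) (by norm_num)
  have s1 := slope 1 (by norm_num) β₁ γ₁ (2 * b₁) h1 fun k hk hkr => (hb1 k hk hkr).2
  have s0 := slope 0 (by norm_num) β₀ γ₀ (2 * b₀) h0 fun k hk hkr => (hb0 k hk hkr).2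
  have e1 := (hb1 1 one_pos rfl).2
  have e0 := (hb0 2 two_pos rfl).2
  rw [s1] at e1
  rw [s0] at e0
  push_cast at e1 e0
  have step : scaledCount 2 (frontier (convexHull ℝ T)) =
      2 * scaledCount 1 (frontier (convexHull ℝ T)) ↔ ∑ e ∈ 𝓔, β₁ e = ∑ e ∈ 𝓔, β₀ e := by
    rw [← Nat.cast_inj (R := ℝ), Nat.cast_mul, e1, e0]
    constructor <;> intro h <;> push_cast at h ⊢ <;> linarith
  rw [step, Finset.sum_eq_sum_iff_of_le fun e he => hle e he]
  exact ⟨fun h e he => (hiff e ((hmem e).2 he)).1 (h e ((hmem e).2 he)),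
    fun h e he => (hiff e he).2 (h e ((hmem e).1 he))⟩

end Edges

/-! ### Quasi-polynomials -/

namespace QuasiPolynomial

variable {n : ℕ}

/-- A quasi-polynomial is determined by its values at the positive integers. -/
theorem eq_of_eval_eq {q q' : QuasiPolynomial n}
    (h : ∀ k : ℕ, 0 < k → q.eval (k : ℤ) = q'.eval (k : ℤ)) : q = q' := by
  choose p hp0 hp using q.periodic
  choose p' hp0' hp' using q'.periodic
  set N := ∏ j, (p j * p' j) with hN
  have hN0 : 0 < N := Finset.prod_pos fun j _ => Nat.mul_pos (hp0 j) (hp0' j)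
  have hper : ∀ j (m : ℕ) (t : ℤ), q.coeff j (t + N * m) = q.coeff j t := by
    intro j m t
    obtain ⟨d, hd⟩ : p j ∣ N :=
      (Dvd.intro _ rfl).trans (Finset.dvd_prod_of_mem (fun j => p j * p' j) (Finset.mem_univ j))
    have := (hp j).nat_mul (d * m) t
    rw [← this, hd]
    congr 2
    push_cast; ring
  have hper' : ∀ j (m : ℕ) (t : ℤ), q'.coeff j (t + N * m) = q'.coeff j t := by
    intro j m t
    obtain ⟨d, hd⟩ : p' j ∣ N :=
      (Dvd.intro_left _ rfl).trans
        (Finset.dvd_prod_of_mem (fun j => p j * p' j) (Finset.mem_univ j))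
    have := (hp' j).nat_mul (d * m) t
    rw [← this, hd]
    congr 2
    push_cast; ring
  ext j t
  set f : ℚ[X] := ∑ i : Fin (n + 1), Polynomial.monomial (i : ℕ) (q.coeff i t - q'.coeff i t)
    with hf
  -- `f` vanishes along the arithmetic progression `t + N m`
  have hf0 : f = 0 := by
    apply Polynomial.eq_zero_of_infinite_isRoot
    have hinj : Function.Injective fun m : ℕ => ((t + N * (m + t.natAbs + 1 : ℕ) : ℤ) : ℚ) := by
      intro a b hab
      have hab' : (t + N * (a + t.natAbs + 1 : ℕ) : ℤ) = t + N * (b + t.natAbs + 1 : ℕ) :=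
        Int.cast_injective (α := ℚ) hab
      have h1 : (N : ℤ) * (a + t.natAbs + 1 : ℕ) = N * (b + t.natAbs + 1 : ℕ) := by linarith
      have h2 := mul_left_cancel₀ (by exact_mod_cast hN0.ne' : (N : ℤ) ≠ 0) h1
      have h3 : a + t.natAbs + 1 = b + t.natAbs + 1 := by exact_mod_cast h2
      omega
    refine (Set.infinite_range_of_injective hinj).mono ?_
    rintro _ ⟨m, rfl⟩
    set M := m + t.natAbs + 1 with hM
    have hpos : 0 < t + N * (M : ℕ) := by
      have h1 : (M : ℤ) ≤ N * M := le_mul_of_one_le_left (by positivity) (by exact_mod_cast hN0)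
      omega
    have hk := h (t + N * (M : ℕ)).toNat (by omega)
    rw [Int.toNat_of_nonneg hpos.le] at hk
    simp only [eval, hper, hper'] at hk
    show f.eval _ = 0
    rw [hf, Polynomial.eval_finsetSum]
    simp only [Polynomial.eval_monomial, sub_mul, Finset.sum_sub_distrib]
    rw [sub_eq_zero]
    exact hk
  have := congrArg (fun g => Polynomial.coeff g (j : ℕ)) hf0
  simp only [hf, Polynomial.finsetSum_coeff, Polynomial.coeff_monomial,
    Polynomial.coeff_zero] at this
  rw [Finset.sum_eq_single j (fun i _ hij => if_neg fun h => hij (Fin.ext h)) (by simp),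
    if_pos rfl] at this
  exact sub_eq_zero.1 this

theorem periodSequence_eq_one_iff {q : QuasiPolynomial n} {k : Fin (n + 1)} :
    q.periodSequence k = 1 ↔ Function.Periodic (q.coeff k) 1 := by
  rw [periodSequence]
  constructor
  · intro h
    have hne : {p : ℕ | 0 < p ∧ Function.Periodic (q.coeff k) (p : ℤ)}.Nonempty := q.periodic k
    have := Nat.sInf_mem hne
    rw [h] at this
    exact_mod_cast this.2
  · intro h
    have hmem : 1 ∈ {p : ℕ | 0 < p ∧ Function.Periodic (q.coeff k) (p : ℤ)} :=
      ⟨one_pos, by exact_mod_cast h⟩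
    exact le_antisymm (Nat.sInf_le hmem) (Nat.sInf_mem ⟨1, hmem⟩).1

theorem quasiPeriod_eq_one_iff {q : QuasiPolynomial n} :
    q.quasiPeriod = 1 ↔ ∀ k, q.periodSequence k = 1 := by
  rw [quasiPeriod]
  constructor
  · intro h k
    exact Nat.dvd_one.1 (h ▸ Finset.dvd_lcm (Finset.mem_univ k))
  · intro h
    exact Nat.dvd_one.1 (Finset.lcm_dvd fun k _ => (h k).dvd)

end QuasiPolynomial

theorem periodic_ite_even_iff {x y : ℚ} :
    Function.Periodic (fun t : ℤ => if Even t then x else y) 1 ↔ x = y := by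
  constructor
  · intro h
    have := h 0
    simpa [eq_comm] using this
  · rintro rfl t
    simp

theorem eq_iff_forall_eval_eq {s : ℤ → Prop} (hs : {t : ℤ | s t}.Infinite) {f : ℤ → ℝ}
    {p₀ : ℝ[X]} (h₀ : ∀ k, s k → f k = p₀.eval (k : ℝ)) (p : ℝ[X]) :
    (∀ k, s k → f k = p.eval (k : ℝ)) ↔ p = p₀ := by
  constructor
  · intro h
    refine Polynomial.eq_of_infinite_eval_eq _ _
      ((hs.image (Int.cast_injective (α := ℝ)).injOn).mono ?_)
    rintro _ ⟨k, hk, rfl⟩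
    exact (h k hk).symm.trans (h₀ k hk)
  · rintro rfl
    exact h₀

theorem infinite_setOf_odd : {t : ℤ | Odd t}.Infinite := by
  refine (Set.infinite_range_of_injective (f := fun m : ℤ => 2 * m + 1) ?_).mono ?_
  · intro a b h
    dsimp only at h
    omega
  · rintro _ ⟨m, rfl⟩
    exact ⟨m, rfl⟩

theorem infinite_setOf_even : {t : ℤ | Even t}.Infinite := by
  refine (Set.infinite_range_of_injective (f := fun m : ℤ => 2 * m) ?_).mono ?_
  · intro a b h
    dsimp only at h
    omega
  · rintro _ ⟨m, rfl⟩
    exact even_two_mul m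

/-- The quadratic quasi-polynomial with constant leading coefficient `a` and lower coefficients
`b₀, g₀` at even and `b₁, g₁` at odd integers. -/
def parityQuasiPolynomial (a b₀ b₁ g₀ g₁ : ℚ) (ha : a ≠ 0) : QuasiPolynomial 2 where
  coeff := ![fun t => if Even t then g₀ else g₁, fun t => if Even t then b₀ else b₁, fun _ => a]
  periodic := by
    have h : ∀ x y : ℚ, Function.Periodic (fun t : ℤ => if Even t then x else y) ((2 : ℕ) : ℤ) := by
      intro x y t
      simp
    intro k
    fin_cases k
    · exact ⟨2, two_pos, h _ _⟩
    · exact ⟨2, two_pos, h _ _⟩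
    · exact ⟨1, one_pos, fun _ => rfl⟩
  coeff_last_ne_zero := fun h => ha (congrFun h 0)

theorem parityQuasiPolynomial_eval {a b₀ b₁ g₀ g₁ : ℚ} (ha : a ≠ 0) (t : ℤ) :
    (parityQuasiPolynomial a b₀ b₁ g₀ g₁ ha).eval t =
      if Even t then a * t ^ 2 + b₀ * t + g₀ else a * t ^ 2 + b₁ * t + g₁ := by
  rw [QuasiPolynomial.eval]
  refine (Fin.sum_univ_three _).trans ?_
  simp only [parityQuasiPolynomial]
  split_ifs with h <;> simp [h] <;> ring

end Ehrhart

theorem mainTheorem10 (P : Set (Fin 2 → ℝ)) (hP : Ehrhart.IsHalfIntegralPolygon P) :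
    ∃ q : Ehrhart.QuasiPolynomial 2,
      -- `q` is the unique Ehrhart quasi-polynomial of `P`
      Ehrhart.IsEhrhart P q ∧
      (∀ q' : Ehrhart.QuasiPolynomial 2, Ehrhart.IsEhrhart P q' → q' = q) ∧
      -- its odd part and its even part
      (∀ p : ℝ[X], q.IsOddPart p ↔
        p = C (Ehrhart.area P) * X ^ 2 + C ((Ehrhart.boundaryCount P : ℝ) / 2) * X
          + C ((Ehrhart.latticeCount P : ℝ) - Ehrhart.area P
              - (Ehrhart.boundaryCount P : ℝ) / 2)) ∧
      (∀ p : ℝ[X], q.IsEvenPart p ↔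
        p = C (Ehrhart.area P) * X ^ 2
          + C ((Ehrhart.boundaryCount ((2 : ℝ) • P) : ℝ) / 4) * X + C 1) ∧
      -- the period sequence is `(1, *, 1)` iff Pick's formula holds
      ((q.periodSequence 0 = 1 ∧ q.periodSequence 2 = 1) ↔
        (Ehrhart.latticeCount P : ℝ) - Ehrhart.area P
          - (Ehrhart.boundaryCount P : ℝ) / 2 = 1) ∧
      ((Ehrhart.latticeCount P : ℝ) - Ehrhart.area P
          - (Ehrhart.boundaryCount P : ℝ) / 2 = 1 ↔ Ehrhart.ObeysPick P) ∧
      -- the period sequence is `(*, 1, 1)` iff every edge contains a lattice point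
      ((q.periodSequence 1 = 1 ∧ q.periodSequence 2 = 1) ↔
        ∀ e : Set (Fin 2 → ℝ), Ehrhart.IsEdge P e → (e ∩ Ehrhart.intLattice 2).Nonempty) ∧
      -- the criterion for pseudo-integrality
      (Ehrhart.IsPseudoIntegral P ↔
        Ehrhart.ObeysPick P ∧
        ∀ e : Set (Fin 2 → ℝ), Ehrhart.IsEdge P e → (e ∩ Ehrhart.intLattice 2).Nonempty) := by
  open Ehrhart in
  obtain ⟨T, hT, hT2, hPT⟩ := hP.exists_vertices
  have hint : (interior P).Nonempty := by
    rw [hPT, interior_convexHull_nonempty_iff_affineSpan_eq_top, ← affineSpan_convexHull, ← hPT]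
    exact hP.1.2
  have hcpt : IsCompact P := hPT ▸ hT.isCompact_convexHull ℝ
  obtain ⟨β₁, γ₁, -, h1⟩ := polygon_counts hT hT2 (hPT ▸ hint) (r := 1) (by norm_num)
  obtain ⟨β₀, γ₀, hγ₀, h0⟩ := polygon_counts hT hT2 (hPT ▸ hint) (r := 0) (by norm_num)
  have hedges := frontier_count_two_eq_iff hT hT2 (hPT ▸ hint)
  rw [← hPT] at h1 h0 hedges
  have hγ₀ := hγ₀ rfl
  have hl1 : scaledCount 1 P = latticeCount P := by
    rw [← latticeCount_smul one_pos, Nat.cast_one, one_smul]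
  have hb1 : scaledCount 1 (frontier P) = boundaryCount P := by
    rw [← boundaryCount_smul one_pos, Nat.cast_one, one_smul]
  have hb2 : scaledCount 2 (frontier P) = boundaryCount ((2 : ℝ) • P) := by
    rw [← boundaryCount_smul two_pos, Nat.cast_ofNat]
  obtain ⟨e1, f1⟩ := h1 1 one_pos rfl
  obtain ⟨e3, -⟩ := h1 3 three_pos rfl
  obtain ⟨-, f2⟩ := h0 2 two_pos rfl
  rw [hl1] at e1
  rw [hb1] at f1 hedges
  rw [hb2] at f2 hedges
  push_cast at e1 e3 f1 f2
  have hβ₁ : β₁ = (boundaryCount P : ℝ) / 2 := by linarith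
  have hβ₀ : β₀ = (boundaryCount ((2 : ℝ) • P) : ℝ) / 4 := by linarith
  have hγ₁ : γ₁ = (latticeCount P : ℝ) - area P - (boundaryCount P : ℝ) / 2 := by linarith
  -- the area is rational, being determined by three counts
  set a : ℚ := ((scaledCount 3 P : ℚ) - latticeCount P - boundaryCount P) / 8 with hadef
  have ha : (a : ℝ) = area P := by
    rw [hadef]; push_cast; linarith
  have hapos : 0 < area P := by
    have : 0 < volume P := lt_of_lt_of_le (isOpen_interior.measure_pos volume hint)
      (measure_mono interior_subset)
    exact ENNReal.toReal_pos this.ne' hcpt.measure_lt_top.ne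
  have ha0 : a ≠ 0 := by
    rintro h
    rw [h, Rat.cast_zero] at ha
    exact hapos.ne ha
  set b₁ : ℚ := (boundaryCount P : ℚ) / 2 with hb₁
  set b₀ : ℚ := (boundaryCount ((2 : ℝ) • P) : ℚ) / 4 with hb₀
  set g₁ : ℚ := (latticeCount P : ℚ) - a - boundaryCount P / 2 with hg₁
  have cb₁ : (b₁ : ℝ) = (boundaryCount P : ℝ) / 2 := by rw [hb₁]; push_cast; rfl
  have cb₀ : (b₀ : ℝ) = (boundaryCount ((2 : ℝ) • P) : ℝ) / 4 := by rw [hb₀]; push_cast; rfl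
  have cg₁ : (g₁ : ℝ) = (latticeCount P : ℝ) - area P - (boundaryCount P : ℝ) / 2 := by
    rw [hg₁]; push_cast; rw [ha]
  set q := parityQuasiPolynomial a b₀ b₁ 1 g₁ ha0 with hq
  have hE : IsEhrhart P q := by
    intro k hk
    rw [hq, parityQuasiPolynomial_eval, latticeCount_smul hk, ← Rat.cast_inj (α := ℝ)]
    split_ifs with hev
    · have hk2 : k % 2 = 0 := Nat.even_iff.1 (by exact_mod_cast hev)
      push_cast
      rw [(h0 k hk hk2).1, ha, cb₀, hβ₀, hγ₀]
    · have hk2 : k % 2 = 1 := Nat.not_even_iff.1 (by exact_mod_cast hev)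
      push_cast
      rw [(h1 k hk hk2).1, ha, cb₁, cg₁, hβ₁, hγ₁]
  have huniq : ∀ q' : QuasiPolynomial 2, IsEhrhart P q' → q' = q := fun q' hq' =>
    QuasiPolynomial.eq_of_eval_eq fun k hk => (hq' k hk).trans (hE k hk).symm
  have hp2 : q.periodSequence 2 = 1 :=
    QuasiPolynomial.periodSequence_eq_one_iff.2 fun _ => rfl
  have hp0 : q.periodSequence 0 = 1 ↔
      (latticeCount P : ℝ) - area P - (boundaryCount P : ℝ) / 2 = 1 := by
    rw [QuasiPolynomial.periodSequence_eq_one_iff, ← cg₁]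
    refine periodic_ite_even_iff.trans ?_
    rw [eq_comm]
    exact_mod_cast Iff.rfl
  have hp1 : q.periodSequence 1 = 1 ↔ ∀ e, IsEdge P e → (e ∩ intLattice 2).Nonempty := by
    rw [QuasiPolynomial.periodSequence_eq_one_iff, ← hedges]
    refine periodic_ite_even_iff.trans ?_
    rw [← Nat.cast_inj (R := ℚ)]
    push_cast
    constructor <;> intro h <;> linarith
  have hpick : (latticeCount P : ℝ) - area P - (boundaryCount P : ℝ) / 2 = 1 ↔ ObeysPick P := by
    rw [ObeysPick, latticeCount_eq_interior_add_boundary hcpt.isClosed hcpt.isBounded]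
    push_cast
    constructor <;> intro h <;> linarith
  refine ⟨q, hE, huniq, ?_, ?_, ?_, hpick, ?_, ?_⟩
  · refine eq_iff_forall_eval_eq infinite_setOf_odd fun k hk => ?_
    rw [hq, parityQuasiPolynomial_eval, if_neg (Int.not_even_iff_odd.2 hk)]
    push_cast
    rw [ha, cb₁, cg₁]
    simp
  · refine eq_iff_forall_eval_eq infinite_setOf_even fun k hk => ?_
    rw [hq, parityQuasiPolynomial_eval, if_pos hk]
    push_cast
    rw [ha, cb₀]
    simp
  · rw [hp0, and_iff_left hp2]
  · rw [hp1, and_iff_left hp2]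
  · have : IsPseudoIntegral P ↔ q.quasiPeriod = 1 :=
      ⟨fun ⟨q', hq', h⟩ => huniq q' hq' ▸ h, fun h => ⟨q, hE, h⟩⟩
    rw [this, QuasiPolynomial.quasiPeriod_eq_one_iff, ← hpick, ← hp0, ← hp1]
    refine ⟨fun h => ⟨h 0, h 1⟩, fun ⟨x, y⟩ k => ?_⟩
    fin_cases k
    · exact x
    · exact y
    · exact hp2
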